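/- All graphs are finite and simple. A set $D$ of vertices of a graph $G$ is a dissociation set if the induced subgraph $G[D]$ has maximum degree at most $1$; the empty set is a dissociation set. Let $d(G)$ denote the number of dissociation sets of $G$. For $t\ge 0$ and $r\ge 1$, let $K_r\ast tK_2$ be the graph obtained from the disjoint union of the complete graph $K_r$ and $t$ copies of $K_2$ by picking a vertex $u$ of $K_r$ and joining $u$ to exactly one vertex of each copy of $K_2$. Let $P_6$ be the path on $6$ vertices. For an integer $n\ge 1$ put $$f(n)=\begin{cases}2^{n-1}+(n+3)\cdot 2^{\frac{n-5}{2}}, & n\text{ odd},\\ 2^{n-1}+(n+6)\cdot 2^{\frac{n-6}{2}}, & n\text{ even},\end{cases} \qquad F_n=\begin{cases}K_1\ast \frac{n-1}{2}K_2, & n\text{ odd},\\ P_6\text{ or }K_2\ast 2K_2, & n=6,\\ K_2\ast\frac{n-2}{2}K_2, & n\text{ even},\ n\ne 6.\end{cases}$$ **Theorem.** Every tree $T$ of order $n\ge 1$ satisfies $d(T)\le f(n)$, with equality if and only if $T\cong F_n$ (for $n=6$: if and only if $T\cong P_6$ or $T\cong K_2\ast 2K_2$). -/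

import Mathlib

/-- A set `S` of vertices of `G` is a dissociation set if every vertex of the induced subgraph
`G[S]` has degree at most `1` in `G[S]`. -/
def IsDissociationSet {V : Type*} (G : SimpleGraph V) (S : Set V) : Prop :=
  ∀ v : S, ((G.induce S).neighborSet v).encard ≤ 1

/-- `d(G)`: the total number of dissociation sets of `G` (the empty set is counted). -/
noncomputable def numDissociationSets {V : Type*} (G : SimpleGraph V) : ℕ :=
  {S : Set V | IsDissociationSet G S}.ncard

/-- The graph `K_r ∗ t K_s`: the disjoint union of a complete graph `K_r` (on `Fin r`) and of `t`
complete graphs `K_s` (the `i`-th one on `{i} × Fin s`), in which the vertex `0` of `K_r` is joined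
to exactly one vertex, `(i, 0)`, of each of the `t` copies of `K_s`. -/
def completeStar (r t s : ℕ) : SimpleGraph (Fin r ⊕ Fin t × Fin s) where
  Adj
    | Sum.inl a, Sum.inl b => a ≠ b
    | Sum.inl a, Sum.inr y => a.val = 0 ∧ y.2.val = 0
    | Sum.inr x, Sum.inl b => b.val = 0 ∧ x.2.val = 0
    | Sum.inr x, Sum.inr y => x.1 = y.1 ∧ x.2 ≠ y.2
  symm := ⟨by
    rintro (a | x) (b | y) h
    · exact Ne.symm h
    · exact h
    · exact h
    · exact ⟨h.1.symm, Ne.symm h.2⟩⟩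
  loopless := ⟨by
    rintro (a | x) h
    · exact h rfl
    · exact h.2 rfl⟩

/-- The extremal value `f(n)`. The exponents are integers and may be negative for small `n`; by
the parity of `n` the integer divisions by `2` are exact. -/
def extremalValue (n : ℕ) : ℚ :=
  if Odd n then 2 ^ ((n : ℤ) - 1) + ((n : ℚ) + 3) * 2 ^ (((n : ℤ) - 5) / 2)
  else 2 ^ ((n : ℤ) - 1) + ((n : ℚ) + 6) * 2 ^ (((n : ℤ) - 6) / 2)

/-- `G ≅ F_n`, where `F_n` is `K_1 ∗ ((n-1)/2) K_2` for odd `n`, either of `P_6` and `K_2 ∗ 2 K_2`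
for `n = 6`, and `K_2 ∗ ((n-2)/2) K_2` for even `n ≠ 6`. -/
def IsoExtremalTree {V : Type*} (n : ℕ) (G : SimpleGraph V) : Prop :=
  if Odd n then Nonempty (G ≃g completeStar 1 ((n - 1) / 2) 2)
  else if n = 6 then
    Nonempty (G ≃g SimpleGraph.pathGraph 6) ∨ Nonempty (G ≃g completeStar 2 2 2)
  else Nonempty (G ≃g completeStar 2 ((n - 2) / 2) 2)

/-!
Write `f(n) = 2 ^ (n - 1) + e(n)`, where `e` is the function `excess`; it satisfies
`e(n) = 2 e(n - 2) + 2 ^ ⌊(n - 3) / 2⌋`. All counting takes place inside a fixed vertex type: `d(A)`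
is the number of dissociation sets contained in the finset `A`, and the bound is proved for every
`A` on which the graph induces a tree, by strong induction on `#A`.

A tree with at least three vertices has a leaf `p` whose neighbour `c` either has degree two or
carries a second leaf (`IsTreeOn.exists_leaf`).

*Degree two.* Let `z` be the other neighbour of `c` and `B = A \ {p, c, z}`. Then
`d(A) = 2 d(B ∪ {z}) + 2 d(B) + d(B \ N(z))` (`numDissoc_pendant`), and the first summand is bounded
by induction. If `B` is itself a dissociation set, then `A` is a star some of whose edges are
subdivided, with centre `z`: here `d(B) = 2 ^ #B`, and the number `k` of neighbours of `z` in `B` is at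
least `#B / 2`, so that `d(B \ N(z)) = 2 ^ (#B - k) ≤ 2 ^ ⌊#B / 2⌋`. This is the recursion for `e`,
with equality only if `k` is as small as possible, that is, if `A` is a spider (`IsSpiderOn`).
Otherwise some vertex of `B` has two
neighbours in `B`, hence at least one eighth of the subsets of `B` is lost (`numDissoc_add_le`). For
`k ≥ 2` this loss outweighs `d(B \ N(z)) ≤ 2 ^ (#B - k)`. For `k = 1` the set `B` is a tree, and its
own bound suffices; this case is tight only for `#B = 3`, where it yields the path on six vertices.

*Two leaves at a common neighbour `v` of degree at least three.* Here
`d(A) = d(A \ {x}) + d(A \ {x, v}) + d(A \ N[v])` for a leaf `x` at `v` (`numDissoc_leaf`), and the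
same estimates show that `A` is never extremal (`IsTreeOn.numDissoc_lt_of_twins`).

Conversely, spiders attain `f` by the same recursion (`IsSpiderOn.numDissoc_eq`), and in a tree the
spider condition determines the graph up to isomorphism (`IsSpiderOn.exists_iso`).
-/

/-! ### Counting dissociation sets -/

section
open Finset

variable {V : Type*} (G : SimpleGraph V) [DecidableRel G.Adj]

/-- The neighbours of `v` that lie in `A`. -/
def nbrsIn (A : Finset V) (v : V) : Finset V := {w ∈ A | G.Adj v w}

/-- A finset `S` is a dissociation set of `G`. -/
def IsDissoc (S : Finset V) : Prop := ∀ v ∈ S, #(nbrsIn G S v) ≤ 1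

instance : DecidablePred (IsDissoc G) := fun S => by unfold IsDissoc; infer_instance

/-- The number of dissociation sets of `G` contained in `A`. -/
def numDissoc (A : Finset V) : ℕ := #{S ∈ A.powerset | IsDissoc G S}

variable {G}

@[simp] lemma mem_nbrsIn {A : Finset V} {v w : V} : w ∈ nbrsIn G A v ↔ w ∈ A ∧ G.Adj v w := by
  simp [nbrsIn]

lemma nbrsIn_subset (A : Finset V) (v : V) : nbrsIn G A v ⊆ A := filter_subset _ _

lemma nbrsIn_mono {A B : Finset V} (h : A ⊆ B) (v : V) : nbrsIn G A v ⊆ nbrsIn G B v :=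
  filter_subset_filter _ h

lemma IsDissoc.mono {S T : Finset V} (hT : IsDissoc G T) (h : S ⊆ T) : IsDissoc G S :=
  fun v hv => (card_le_card (nbrsIn_mono h v)).trans (hT v (h hv))

lemma not_isDissoc_of_two {S : Finset V} {w x y : V} (hw : w ∈ S) (hx : x ∈ S) (hy : y ∈ S)
    (hwx : G.Adj w x) (hwy : G.Adj w y) (hxy : x ≠ y) : ¬ IsDissoc G S := by
  intro h
  exact hxy (card_le_one.1 (h w hw) x (by simp [hx, hwx]) y (by simp [hy, hwy]))

lemma exists_two_of_not_isDissoc {S : Finset V} (h : ¬ IsDissoc G S) :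
    ∃ w ∈ S, ∃ x ∈ S, ∃ y ∈ S, G.Adj w x ∧ G.Adj w y ∧ x ≠ y := by
  unfold IsDissoc at h
  push Not at h
  obtain ⟨w, hw, h⟩ := h
  obtain ⟨x, hx, y, hy, hxy⟩ := one_lt_card.1 h
  simp only [mem_nbrsIn] at hx hy
  exact ⟨w, hw, x, hx.1, y, hy.1, hx.2, hy.2, hxy⟩

lemma numDissoc_le (A : Finset V) : numDissoc G A ≤ 2 ^ #A :=
  (card_filter_le _ _).trans (card_powerset A).le

lemma numDissoc_eq_of_isDissoc {A : Finset V} (h : IsDissoc G A) : numDissoc G A = 2 ^ #A := by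
  rw [numDissoc, filter_true_of_mem, card_powerset]
  exact fun S hS => h.mono (mem_powerset.1 hS)

variable [DecidableEq V]

/-- The number of subsets of `A` whose union with `F` is a dissociation set. -/
def numDissocExt (G : SimpleGraph V) [DecidableRel G.Adj] (F A : Finset V) : ℕ := #{S ∈ A.powerset | IsDissoc G (S ∪ F)}

/-- The union of two dissociation sets with no edge between them is a dissociation set. -/
lemma isDissoc_union_iff {S F : Finset V} (hF : IsDissoc G F)
    (h : ∀ u ∈ F, ∀ v ∈ S, ¬ G.Adj u v) : IsDissoc G (S ∪ F) ↔ IsDissoc G S := by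
  refine ⟨fun h => h.mono subset_union_left, fun hS => ?_⟩
  by_contra hn
  obtain ⟨w, hw, x, hx, y, hy, hwx, hwy, hxy⟩ := exists_two_of_not_isDissoc hn
  have key : ∀ a b, a ∈ S ∪ F → b ∈ S ∪ F → G.Adj a b → a ∈ S → b ∈ S := by
    intro a b _ hb hab ha
    rcases mem_union.1 hb with hb | hb
    · exact hb
    · exact absurd hab.symm (h b hb a ha)
  have key' : ∀ a b, a ∈ S ∪ F → b ∈ S ∪ F → G.Adj a b → a ∈ F → b ∈ F := by
    intro a b _ hb hab ha
    rcases mem_union.1 hb with hb | hb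
    · exact absurd hab (h a ha b hb)
    · exact hb
  rcases mem_union.1 hw with hw' | hw'
  · exact not_isDissoc_of_two hw' (key w x hw hx hwx hw') (key w y hw hy hwy hw') hwx hwy hxy hS
  · exact not_isDissoc_of_two hw' (key' w x hw hx hwx hw') (key' w y hw hy hwy hw') hwx hwy hxy hF

/-- If some vertex of `A` has two neighbours in `A`, then at least one eighth of the subsets of `A`
are not dissociation sets, namely those containing all three vertices. -/
lemma numDissoc_add_le {A : Finset V} (h : ¬ IsDissoc G A) :
    numDissoc G A + 2 ^ (#A - 3) ≤ 2 ^ #A := by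
  obtain ⟨w, hw, x, hx, y, hy, hwx, hwy, hxy⟩ := exists_two_of_not_isDissoc h
  have hsub : ({w, x, y} : Finset V) ⊆ A := by
    intro a; simp only [mem_insert, mem_singleton]; rintro (rfl | rfl | rfl) <;> assumption
  have h3 : #({w, x, y} : Finset V) = 3 := by
    rw [card_insert_of_notMem, card_pair hxy]
    simp [hwx.ne, hwy.ne]
  have hbad : 2 ^ (#A - 3) ≤ #{S ∈ A.powerset | ¬ IsDissoc G S} := by
    rw [← h3, ← card_sdiff_of_subset hsub, ← card_powerset]
    refine card_le_card_of_injOn (fun S => S ∪ {w, x, y}) ?_ ?_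
    · intro S hS
      have hS' := mem_powerset.1 (mem_coe.1 hS)
      simp only [coe_filter, mem_powerset, Set.mem_ofPred_eq]
      refine ⟨union_subset (hS'.trans sdiff_subset) hsub, ?_⟩
      exact not_isDissoc_of_two (w := w) (x := x) (y := y) (by simp) (by simp) (by simp) hwx hwy hxy
    · intro S hS T hT hST
      have hS' := mem_powerset.1 (mem_coe.1 hS)
      have hT' := mem_powerset.1 (mem_coe.1 hT)
      have e : ∀ {U : Finset V}, U ⊆ A \ {w, x, y} → (U ∪ {w, x, y}) \ {w, x, y} = U := by
        intro U hU
        rw [union_sdiff_right]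
        exact sdiff_eq_self_of_disjoint (disjoint_of_subset_left hU sdiff_disjoint)
      have := congrArg (· \ ({w, x, y} : Finset V)) hST
      simpa only [e hS', e hT'] using this
  have := card_filter_add_card_filter_not (s := A.powerset) (fun S => IsDissoc G S)
  rw [card_powerset] at this
  unfold numDissoc
  omega

lemma numDissocExt_empty (A : Finset V) : numDissocExt G ∅ A = numDissoc G A := by
  simp [numDissocExt, numDissoc]

/-- Branching on whether the vertex `x` is taken. -/
lemma numDissocExt_insert {F A : Finset V} {x : V} (hx : x ∉ A) :
    numDissocExt G F (insert x A) = numDissocExt G F A + numDissocExt G (insert x F) A := by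
  unfold numDissocExt
  rw [powerset_insert, filter_union, card_union_of_disjoint, filter_image, card_image_of_injOn]
  · congr 2
    ext S
    simp [insert_union, union_insert]
  · intro S hS T hT h
    have hS' : x ∉ S := fun h' => hx (mem_powerset.1 (mem_filter.1 (mem_coe.1 hS)).1 h')
    have hT' : x ∉ T := fun h' => hx (mem_powerset.1 (mem_filter.1 (mem_coe.1 hT)).1 h')
    simpa [erase_insert hS', erase_insert hT'] using congrArg (fun U => U.erase x) h
  · rw [disjoint_left]
    intro S hS hS'
    obtain ⟨T, -, rfl⟩ := mem_image.1 (mem_filter.1 hS').1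
    exact hx (mem_powerset.1 (mem_filter.1 hS).1 (mem_insert_self _ _))

lemma numDissocExt_eq_of_no_adj {F A : Finset V} (hF : IsDissoc G F)
    (h : ∀ u ∈ F, ∀ v ∈ A, ¬ G.Adj u v) : numDissocExt G F A = numDissoc G A := by
  unfold numDissocExt numDissoc
  congr 1
  refine filter_congr fun S hS => isDissoc_union_iff hF fun u hu v hv => h u hu v ?_
  exact mem_powerset.1 hS hv

/-- Vertices that conflict with the part `F` already chosen may be discarded. -/
lemma numDissocExt_sdiff {F A N : Finset V} (h : ∀ v ∈ A, v ∈ N → ¬ IsDissoc G (insert v F)) :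
    numDissocExt G F A = numDissocExt G F (A \ N) := by
  unfold numDissocExt
  congr 1
  ext S
  simp only [mem_filter, mem_powerset]
  refine ⟨fun ⟨hS, hd⟩ => ⟨fun v hv => mem_sdiff.2 ⟨hS hv, fun hN => h v (hS hv) hN ?_⟩, hd⟩,
    fun ⟨hS, hd⟩ => ⟨hS.trans sdiff_subset, hd⟩⟩
  refine hd.mono (insert_subset (mem_union_left _ hv) subset_union_right)

lemma numDissocExt_eq_zero {F A : Finset V} (h : ¬ IsDissoc G F) : numDissocExt G F A = 0 := by
  unfold numDissocExt
  rw [card_eq_zero, filter_eq_empty_iff]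
  exact fun S _ hS => h (hS.mono subset_union_right)

lemma isDissoc_of_card_le_two {F : Finset V} (h : #F ≤ 2) : IsDissoc G F := by
  intro v hv
  have : nbrsIn G F v ⊆ F.erase v := fun w hw => by
    simp only [mem_nbrsIn] at hw
    exact mem_erase.2 ⟨hw.2.ne', hw.1⟩
  have h2 := card_le_card this
  rw [card_erase_of_mem hv] at h2
  omega

lemma numDissoc_insert {A : Finset V} {x : V} (hx : x ∉ A) :
    numDissoc G (insert x A) = numDissoc G A + numDissocExt G {x} A := by
  rw [← numDissocExt_empty, numDissocExt_insert hx, numDissocExt_empty]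
  rfl

lemma numDissoc_insert_isolated {A : Finset V} {x : V} (hx : x ∉ A)
    (h : ∀ v ∈ A, ¬ G.Adj x v) : numDissoc G (insert x A) = 2 * numDissoc G A := by
  rw [numDissoc_insert hx, numDissocExt_eq_of_no_adj (isDissoc_of_card_le_two (by simp)), two_mul]
  simpa using h

/-- Once an edge `uv` has been taken, all other neighbours of `u` and `v` are excluded. -/
lemma numDissocExt_edge {A : Finset V} {u v : V} (huv : G.Adj u v) (hu : u ∉ A) (hv : v ∉ A) :
    numDissocExt G {u, v} A = numDissoc G (A \ (nbrsIn G A u ∪ nbrsIn G A v)) := by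
  rw [numDissocExt_sdiff (N := nbrsIn G A u ∪ nbrsIn G A v), numDissocExt_eq_of_no_adj]
  · exact isDissoc_of_card_le_two card_le_two
  · intro a ha b hb hab
    simp only [mem_sdiff, mem_union, mem_nbrsIn, not_or, not_and] at hb
    rcases mem_insert.1 ha with rfl | ha
    · exact hb.2.1 hb.1 hab
    · rw [mem_singleton] at ha
      subst ha
      exact hb.2.2 hb.1 hab
  · intro w hw hwN
    rcases mem_union.1 hwN with h | h
    · exact not_isDissoc_of_two (w := u) (x := v) (y := w) (by simp) (by simp) (by simp) huv
        (mem_nbrsIn.1 h).2 (by rintro rfl; exact hv hw)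
    · exact not_isDissoc_of_two (w := v) (x := u) (y := w) (by simp) (by simp) (by simp) huv.symm
        (mem_nbrsIn.1 h).2 (by rintro rfl; exact hu hw)

/-- The recursion at a pendant path `p - c - z`: `p` is a leaf whose neighbour `c` has degree two.
The three summands count the sets avoiding `c`, those containing `c` but not `z`, and those
containing both. -/
lemma numDissoc_pendant {B : Finset V} {p c z : V} (hp : p ∉ B) (hc : c ∉ B) (hz : z ∉ B)
    (hpc : G.Adj p c) (hcz : G.Adj c z) (hpz : p ≠ z)
    (hpz' : ¬ G.Adj p z) (hpB : ∀ v ∈ B, ¬ G.Adj p v) (hcB : ∀ v ∈ B, ¬ G.Adj c v) :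
    numDissoc G (insert c (insert p (insert z B))) =
      2 * numDissoc G (insert z B) + 2 * numDissoc G B + numDissoc G (B \ nbrsIn G B z) := by
  have h1 : p ∉ insert z B := by simp [hpz, hp]
  have h2 : c ∉ insert p (insert z B) := by simp [hpc.ne', hcz.ne, hc]
  have h3 : z ∉ insert p B := by simp [hpz.symm, hz]
  rw [numDissoc_insert h2, numDissoc_insert_isolated h1, Finset.insert_comm p z B,
    numDissocExt_insert h3, numDissocExt_insert hp, numDissocExt_insert hp,
    numDissocExt_eq_of_no_adj (F := {c}), numDissocExt_eq_of_no_adj (F := {p, c}),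
    numDissocExt_eq_zero (F := {p, z, c}), numDissocExt_edge hcz.symm hz hc]
  · have : nbrsIn G B c = ∅ := by
      rw [eq_empty_iff_forall_notMem]
      intro v hv
      exact hcB v (mem_nbrsIn.1 hv).1 (mem_nbrsIn.1 hv).2
    rw [this, union_empty]
    ring
  · exact not_isDissoc_of_two (w := c) (x := p) (y := z) (by simp) (by simp) (by simp)
      hpc.symm hcz hpz
  · exact isDissoc_of_card_le_two card_le_two
  · simp only [mem_insert, mem_singleton]
    rintro u (rfl | rfl)
    · exact hpB
    · exact hcB
  · exact isDissoc_of_card_le_two (by simp)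
  · simpa using hcB
  · simp only [mem_insert]
    rintro v (rfl | hv)
    · exact hpz'
    · exact hpB v hv

/-- The recursion at a leaf `x` with neighbour `v`: the sets avoiding `x`, those containing `x` but
not `v`, and those containing both. -/
lemma numDissoc_leaf {M : Finset V} {x v : V} (hx : x ∉ M) (hv : v ∉ M) (hxv : G.Adj x v)
    (hxM : ∀ w ∈ M, ¬ G.Adj x w) :
    numDissoc G (insert x (insert v M)) =
      numDissoc G (insert v M) + numDissoc G M + numDissoc G (M \ nbrsIn G M v) := by
  have h2 : x ∉ insert v M := by simp [hxv.ne, hx]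
  rw [numDissoc_insert h2, numDissocExt_insert hv, numDissocExt_eq_of_no_adj (F := {x}),
    numDissocExt_edge hxv.symm hv hx]
  · have : nbrsIn G M x = ∅ := by
      rw [eq_empty_iff_forall_notMem]
      intro v hv
      exact hxM v (mem_nbrsIn.1 hv).1 (mem_nbrsIn.1 hv).2
    rw [this, union_empty]
    ring
  · exact isDissoc_of_card_le_two (by simp)
  · simpa using hxM

end

/-! ### Trees on finsets -/

section
open Finset

variable {V : Type*}

/-- `p` is a leaf of `G[A]` and `c` is its neighbour. -/
def IsLeafAt (G : SimpleGraph V) (A : Finset V) (p c : V) : Prop :=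
  p ∈ A ∧ c ∈ A ∧ ∀ w ∈ A, G.Adj p w ↔ w = c

variable {G : SimpleGraph V} {A : Finset V}

lemma IsLeafAt.adj {p c : V} (h : IsLeafAt G A p c) : G.Adj p c := (h.2.2 c h.2.1).2 rfl

lemma IsLeafAt.mono {p c : V} (h : IsLeafAt G A p c) {B : Finset V} (hB : B ⊆ A) (hp : p ∈ B)
    (hc : c ∈ B) : IsLeafAt G B p c := ⟨hp, hc, fun w hw => h.2.2 w (hB hw)⟩

variable [DecidableEq V]

/-- `G` induces a tree on the finset `A`, i.e. `G[A]` arises from a single vertex by successively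
adding leaves. -/
inductive IsTreeOn (G : SimpleGraph V) : Finset V → Prop
  | single (v : V) : IsTreeOn G {v}
  | leaf {A : Finset V} {x y : V} (hA : IsTreeOn G A) (hx : x ∉ A) (hy : y ∈ A)
      (hxy : ∀ w ∈ A, G.Adj x w ↔ w = y) : IsTreeOn G (insert x A)

/-- Every proper nonempty part of a tree is joined to the rest by an edge. -/
lemma IsTreeOn.exists_adj_of_ne (h : IsTreeOn G A) {C : Finset V} (hC : C ⊆ A)
    (hne : C.Nonempty) (hCA : C ≠ A) : ∃ u ∈ C, ∃ v ∈ A, v ∉ C ∧ G.Adj u v := by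
  induction h generalizing C with
  | single v =>
    rcases subset_singleton_iff.1 hC with rfl | rfl
    · simp at hne
    · exact absurd rfl hCA
  | @leaf A x y hA hx hy hxy ih =>
    have hadj : G.Adj x y := (hxy y hy).2 rfl
    by_cases hyC : y ∈ C
    · by_cases hxC : x ∈ C
      · obtain ⟨u, hu, v, hv, hvC, huv⟩ := ih (C := C.erase x)
          (fun a ha => (mem_insert.1 (hC (mem_of_mem_erase ha))).resolve_left (ne_of_mem_erase ha))
          ⟨y, mem_erase.2 ⟨hadj.ne', hyC⟩⟩
          (fun h => hCA (by rw [← h, insert_erase hxC]))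
        refine ⟨u, mem_of_mem_erase hu, v, mem_insert_of_mem hv, fun h' => hvC ?_, huv⟩
        exact mem_erase.2 ⟨by rintro rfl; exact hx hv, h'⟩
      · exact ⟨y, hyC, x, mem_insert_self _ _, hxC, hadj.symm⟩
    · by_cases hxC : x ∈ C
      · exact ⟨x, hxC, y, mem_insert_of_mem hy, hyC, hadj⟩
      · have hCA' : C ⊆ A := fun a ha =>
          (mem_insert.1 (hC ha)).resolve_left (by rintro rfl; exact hxC ha)
        obtain ⟨u, hu, v, hv, hvC, huv⟩ := ih hCA' hne (by rintro rfl; exact hyC hy)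
        exact ⟨u, hu, v, mem_insert_of_mem hv, hvC, huv⟩

lemma IsTreeOn.exists_adj (h : IsTreeOn G A) (hA : 2 ≤ #A) {v : V} (hv : v ∈ A) :
    ∃ w ∈ A, G.Adj v w := by
  obtain ⟨u, hu, w, hw, -, huw⟩ := h.exists_adj_of_ne (C := {v}) (by simpa) (by simp)
    (by rintro rfl; simp at hA)
  exact ⟨w, hw, by rwa [mem_singleton.1 hu] at huw⟩

lemma IsTreeOn.no_triangle (h : IsTreeOn G A) {a b c : V} (ha : a ∈ A) (hb : b ∈ A) (hc : c ∈ A)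
    (hab : G.Adj a b) (hbc : G.Adj b c) (hac : G.Adj a c) : False := by
  induction h generalizing a b c with
  | single v =>
    rw [mem_singleton] at ha hb
    exact hab.ne (ha.trans hb.symm)
  | @leaf A x y hA hx hy hxy ih =>
    -- the two neighbours of the new leaf in a triangle would coincide
    have key : ∀ {a b : V}, a ∈ insert x A → b ∈ insert x A → G.Adj x a → G.Adj x b →
        a = b := by
      intro a b ha hb h1 h2
      rw [(hxy a ((mem_insert.1 ha).resolve_left h1.ne')).1 h1,
        (hxy b ((mem_insert.1 hb).resolve_left h2.ne')).1 h2]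
    rcases mem_insert.1 ha with rfl | ha'
    · exact hbc.ne (key hb hc hab hac)
    rcases mem_insert.1 hb with rfl | hb'
    · exact hac.ne (key ha hc hab.symm hbc)
    rcases mem_insert.1 hc with rfl | hc'
    · exact hab.ne (key ha hb hac.symm hbc.symm)
    exact ih ha' hb' hc' hab hbc hac

lemma IsTreeOn.erase_leaf (h : IsTreeOn G A) {p c : V} (hp : IsLeafAt G A p c) :
    IsTreeOn G (A.erase p) := by
  induction h with
  | single v =>
    obtain ⟨h1, h2, -⟩ := id hp
    rw [mem_singleton] at h1 h2
    exact absurd (h1.trans h2.symm) hp.adj.ne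
  | @leaf A x y hA hx hy hxy ih =>
    by_cases hpx : p = x
    · subst hpx
      rwa [erase_insert hx]
    · have hpA : p ∈ A := (mem_insert.1 hp.1).resolve_left hpx
      by_cases hyp : y = p
      · subst hyp
        have hcx : x = c :=
          (hp.2.2 x (mem_insert_self _ _)).1 ((hxy y hy).2 rfl).symm
        have hA1 : A = {y} := by
          by_contra hne
          obtain ⟨u, hu, v, hv, -, huv⟩ := hA.exists_adj_of_ne (C := {y}) (by simpa) (by simp)
            (Ne.symm hne)
          rw [mem_singleton] at hu
          subst hu
          have := (hp.2.2 v (mem_insert_of_mem hv)).1 huv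
          exact hx (by rwa [hcx, ← this])
        have : (insert x A).erase y = {x} := by
          ext a
          simp only [hA1, mem_erase, mem_insert, mem_singleton]
          constructor
          · tauto
          · rintro rfl; exact ⟨fun h => hpx h.symm, Or.inl rfl⟩
        rw [this]
        exact .single x
      · have hcA : c ∈ A := (mem_insert.1 hp.2.1).resolve_left (by
          rintro rfl
          exact hyp ((hxy p hpA).1 hp.adj.symm).symm)
        rw [erase_insert_of_ne (Ne.symm hpx)]
        refine .leaf (ih (hp.mono (subset_insert _ _) hpA hcA)) (fun h => hx (mem_of_mem_erase h))
          (mem_erase.2 ⟨hyp, hy⟩) fun w hw => hxy w (mem_of_mem_erase hw)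

/-- Every tree with at least three vertices has a leaf whose neighbour has degree two, or two
leaves with a common neighbour. -/
lemma IsTreeOn.exists_leaf [DecidableRel G.Adj] (h : IsTreeOn G A) (hA : 3 ≤ #A) :
    ∃ p c, IsLeafAt G A p c ∧ (#(nbrsIn G A c) = 2 ∨ ∃ q, q ≠ p ∧ IsLeafAt G A q c) := by
  induction h with
  | single v => simp at hA
  | @leaf A x y hT hx hy hxy ih =>
    have hxy' : G.Adj x y := (hxy y hy).2 rfl
    have hleaf : IsLeafAt G (insert x A) x y := by
      refine ⟨mem_insert_self _ _, mem_insert_of_mem hy, fun w hw => ?_⟩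
      rcases mem_insert.1 hw with rfl | hw
      · simpa using hxy'.ne
      · exact hxy w hw
    have hother : ∀ {p c}, IsLeafAt G A p c → y ≠ p → IsLeafAt G (insert x A) p c := by
      intro p c hp hyp
      refine ⟨mem_insert_of_mem hp.1, mem_insert_of_mem hp.2.1, fun w hw => ?_⟩
      rcases mem_insert.1 hw with rfl | hw
      · refine iff_of_false (fun h => hyp ((hxy p hp.1).1 h.symm).symm) ?_
        rintro rfl; exact hx hp.2.1
      · exact hp.2.2 w hw
    have hdeg : ∀ {c}, IsLeafAt G A y c → #(nbrsIn G (insert x A) y) = 2 := by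
      intro c hc
      have : nbrsIn G (insert x A) y = {x, c} := by
        ext w
        simp only [mem_nbrsIn, mem_insert, mem_singleton]
        constructor
        · rintro ⟨rfl | hw, h⟩
          · exact Or.inl rfl
          · exact Or.inr ((hc.2.2 w hw).1 h)
        · rintro (rfl | rfl)
          · exact ⟨Or.inl rfl, hxy'.symm⟩
          · exact ⟨Or.inr hc.2.1, hc.adj⟩
      rw [this, card_pair]
      rintro rfl; exact hx hc.2.1
    rw [card_insert_of_notMem hx] at hA
    rcases Nat.lt_or_ge #A 3 with h3 | h3
    · obtain ⟨c, hc, hyc⟩ := hT.exists_adj (by omega) hy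
      have hA2 : A = {y, c} := by
        refine (eq_of_subset_of_card_le ?_ ?_).symm
        · simp [insert_subset_iff, hy, hc]
        · rw [card_pair hyc.ne]; omega
      refine ⟨x, y, hleaf, Or.inl (hdeg (c := c) ⟨hy, hc, fun w hw => ?_⟩)⟩
      rw [hA2, mem_insert, mem_singleton] at hw
      rcases hw with rfl | rfl
      · simpa using hyc.ne
      · simpa using hyc
    · obtain ⟨p, c, hp, h⟩ := ih h3
      by_cases hyp : y = p
      · subst hyp
        exact ⟨x, y, hleaf, Or.inl (hdeg hp)⟩
      by_cases hyc : y = c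
      · subst hyc
        exact ⟨x, y, hleaf, Or.inr ⟨p, by rintro rfl; exact hx hp.1, hother hp hyp⟩⟩
      rcases h with h | ⟨q, hqp, hq⟩
      · refine ⟨p, c, hother hp hyp, Or.inl ?_⟩
        rw [← h]
        congr 1
        ext w
        simp only [mem_nbrsIn, mem_insert]
        refine ⟨?_, fun h => ⟨Or.inr h.1, h.2⟩⟩
        rintro ⟨rfl | hw, h⟩
        · exact absurd ((hxy c hp.2.1).1 h.symm).symm hyc
        · exact ⟨hw, h⟩
      · by_cases hyq : y = q
        · subst hyq
          exact ⟨x, y, hleaf, Or.inl (hdeg hq)⟩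
        · exact ⟨p, c, hother hp hyp, Or.inr ⟨q, hqp, hother hq hyq⟩⟩

lemma IsTreeOn.map {W : Type*} [DecidableEq W] {H : SimpleGraph W} (f : G ↪g H)
    (h : IsTreeOn G A) : IsTreeOn H (A.map f.toEmbedding) := by
  induction h with
  | single v => rw [map_singleton]; exact .single _
  | @leaf A x y hA hx hy hxy ih =>
    rw [map_insert]
    refine .leaf ih (by simpa using hx) (mem_map_of_mem _ hy) fun w hw => ?_
    obtain ⟨a, ha, rfl⟩ := mem_map.1 hw
    simpa using hxy a ha

end

lemma SimpleGraph.IsTree.isTreeOn_univ {V : Type*} [Fintype V] [DecidableEq V]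
    {T : SimpleGraph V} (hT : T.IsTree) : IsTreeOn T Finset.univ := by
  classical
  induction hn : Fintype.card V generalizing V with
  | zero =>
    have := hT.connected.nonempty
    exact absurd hn Fintype.card_ne_zero
  | succ n ih =>
    have := hT.connected.nonempty
    rcases subsingleton_or_nontrivial V with hs | hs
    · obtain ⟨v⟩ := this
      rw [Finset.eq_singleton_iff_unique_mem.2 ⟨Finset.mem_univ v, fun x _ => Subsingleton.elim x v⟩]
      exact .single v
    · obtain ⟨x, hx⟩ := hT.exists_vert_degree_one_of_nontrivial
      have hT' : (T.induce {x}ᶜ).IsTree :=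
        ⟨hT.connected.induce_compl_singleton_of_degree_eq_one hx, hT.isAcyclic.induce _⟩
      have h1 := ih hT' (by rw [Fintype.card_compl_set]; simp [hn])
      have h2 := h1.map (SimpleGraph.Embedding.induce _)
      obtain ⟨y, hxy, hy⟩ := T.degree_eq_one_iff_existsUnique_adj.1 hx
      have h3 : Finset.univ.map (SimpleGraph.Embedding.induce (G := T) ({x}ᶜ)).toEmbedding =
          Finset.univ.erase x := by
        ext a; simp
      rw [h3] at h2
      rw [← Finset.insert_erase (Finset.mem_univ x)]
      refine .leaf h2 (by simp) (Finset.mem_erase.2 ⟨hxy.ne', Finset.mem_univ y⟩) fun w _ => ?_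
      exact ⟨fun h => hy w h, by rintro rfl; exact hxy⟩

/-! ### The excess -/

section
open Finset

/-- The excess `f(n) - 2 ^ (n - 1)` of the extremal value, for `n ≥ 1`. -/
def excess : ℕ → ℕ
  | 0 => 0
  | 1 => 1
  | 2 => 2
  | n + 3 => 2 * excess (n + 1) + 2 ^ (n / 2)

lemma excess_add_three (n : ℕ) : excess (n + 3) = 2 * excess (n + 1) + 2 ^ (n / 2) := rfl

lemma two_mul_excess_odd (m : ℕ) : 2 * excess (2 * m + 1) = (m + 2) * 2 ^ m := by
  induction m with
  | zero => rfl
  | succ m ih =>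
    rw [show 2 * (m + 1) + 1 = 2 * m + 3 by ring, excess_add_three,
      show 2 * m / 2 = m by omega, mul_add, ih]
    ring

lemma two_mul_excess_even (m : ℕ) : 2 * excess (2 * m + 2) = (m + 4) * 2 ^ m := by
  induction m with
  | zero => rfl
  | succ m ih =>
    rw [show 2 * (m + 1) + 2 = (2 * m + 1) + 3 by ring, excess_add_three,
      show (2 * m + 1) / 2 = m by omega, mul_add, ih]
    ring

lemma excess_add_lt (k : ℕ) : excess (k + 3) + 2 ^ ((k + 1) / 2) < excess (k + 4) := by
  obtain ⟨j, rfl | rfl⟩ := Nat.even_or_odd' k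
  · have h1 := two_mul_excess_odd (j + 1)
    have h2 := two_mul_excess_even (j + 1)
    rw [show (2 * j + 1) / 2 = j by omega]
    rw [show 2 * (j + 1) + 1 = 2 * j + 3 by ring] at h1
    rw [show 2 * (j + 1) + 2 = 2 * j + 4 by ring] at h2
    have := Nat.two_pow_pos j
    rw [pow_succ] at h1 h2
    nlinarith
  · have h1 := two_mul_excess_even (j + 1)
    have h2 := two_mul_excess_odd (j + 2)
    rw [show (2 * j + 1 + 1) / 2 = j + 1 by omega]
    rw [show 2 * (j + 1) + 2 = 2 * j + 1 + 3 by ring] at h1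
    rw [show 2 * (j + 2) + 1 = 2 * j + 1 + 4 by ring] at h2
    have := Nat.two_pow_pos j
    simp only [pow_succ] at h1 h2 ⊢
    nlinarith

lemma two_mul_excess_add_lt (k : ℕ) :
    2 * excess (k + 1) + excess (k + 3) < 2 ^ k + excess (k + 4) := by
  obtain ⟨j, rfl | rfl⟩ := Nat.even_or_odd' k
  · have h0 := two_mul_excess_odd j
    have h1 := two_mul_excess_odd (j + 1)
    have h2 := two_mul_excess_even (j + 1)
    rw [show 2 * (j + 1) + 1 = 2 * j + 3 by ring] at h1
    rw [show 2 * (j + 1) + 2 = 2 * j + 4 by ring] at h2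
    have := Nat.lt_two_pow_self (n := j)
    rw [pow_mul', sq]
    rw [pow_succ] at h1 h2
    nlinarith
  · have h0 := two_mul_excess_even j
    have h1 := two_mul_excess_even (j + 1)
    have h2 := two_mul_excess_odd (j + 2)
    rw [show 2 * (j + 1) + 2 = 2 * j + 1 + 3 by ring] at h1
    rw [show 2 * (j + 2) + 1 = 2 * j + 1 + 4 by ring] at h2
    have := Nat.two_pow_pos j
    rw [pow_succ 2 (2 * j), pow_mul', sq]
    simp only [pow_succ] at h1 h2
    rw [show 2 * j + 1 + 1 = 2 * j + 2 by ring]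
    nlinarith

lemma two_mul_excess_lt {k : ℕ} (hk : 3 ≤ k) :
    2 * excess (k + 1) < 2 ^ k + 2 ^ ((k + 1) / 2) := by
  have key : ∀ i : ℕ, i + 3 < 2 ^ (i + 2) := by
    intro i
    have := Nat.lt_two_pow_self (n := i)
    rw [pow_add]
    omega
  obtain ⟨j, rfl | rfl⟩ := Nat.even_or_odd' k
  · rw [two_mul_excess_odd, show (2 * j + 1) / 2 = j by omega, pow_mul', sq, ← Nat.add_one_mul]
    refine Nat.mul_lt_mul_of_pos_right ?_ (Nat.two_pow_pos j)
    obtain ⟨i, rfl⟩ := Nat.exists_eq_add_of_le (show 2 ≤ j by omega)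
    have := key i
    rw [add_comm 2 i]
    omega
  · rw [two_mul_excess_even, show (2 * j + 1 + 1) / 2 = j + 1 by omega, pow_succ, pow_mul', sq,
      pow_succ]
    have : j + 4 < 2 ^ j * 2 + 2 := by
      obtain ⟨i, rfl⟩ := Nat.exists_eq_add_of_le (show 1 ≤ j by omega)
      have := key i
      have h2 : 2 ^ (1 + i) * 2 = 2 ^ (i + 2) := by ring
      omega
    nlinarith [Nat.two_pow_pos j]

/-! ### Pendant paths and spiders -/

variable {V : Type*} [DecidableEq V] {G : SimpleGraph V} {A B : Finset V}

/-- In `G[{c, p, z} ∪ B]`, the vertex `p` is a leaf and its neighbour `c` has degree two, the other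
neighbour of `c` being `z`. -/
structure IsPendant (G : SimpleGraph V) (B : Finset V) (p c z : V) : Prop where
  p_notMem : p ∉ B
  c_notMem : c ∉ B
  z_notMem : z ∉ B
  adj_pc : G.Adj p c
  adj_cz : G.Adj c z
  p_ne_z : p ≠ z
  not_adj_pz : ¬ G.Adj p z
  not_adj_p : ∀ v ∈ B, ¬ G.Adj p v
  not_adj_c : ∀ v ∈ B, ¬ G.Adj c v

namespace IsPendant

variable {p c z : V}

lemma notMem_p (h : IsPendant G B p c z) : p ∉ insert z B := by simp [h.p_ne_z, h.p_notMem]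

lemma notMem_c (h : IsPendant G B p c z) : c ∉ insert p (insert z B) := by
  simp [h.adj_pc.ne', h.adj_cz.ne, h.c_notMem]

lemma card_eq (h : IsPendant G B p c z) : #(insert c (insert p (insert z B))) = #B + 3 := by
  rw [card_insert_of_notMem h.notMem_c, card_insert_of_notMem h.notMem_p,
    card_insert_of_notMem h.z_notMem]

lemma isTreeOn (h : IsPendant G B p c z)
    (hT : IsTreeOn G (insert c (insert p (insert z B)))) : IsTreeOn G (insert z B) := by
  have h1 : IsLeafAt G (insert c (insert p (insert z B))) p c := by
    refine ⟨by simp, by simp, ?_⟩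
    simp only [mem_insert]
    rintro w (rfl | rfl | rfl | hw)
    · simpa using h.adj_pc
    · simpa using h.adj_pc.ne
    · exact iff_of_false h.not_adj_pz h.adj_cz.ne'
    · exact iff_of_false (h.not_adj_p w hw) (by rintro rfl; exact h.c_notMem hw)
  have h2 := hT.erase_leaf h1
  rw [erase_insert_of_ne h.adj_pc.ne', erase_insert h.notMem_p] at h2
  have h3 : IsLeafAt G (insert c (insert z B)) c z := by
    refine ⟨by simp, by simp, ?_⟩
    simp only [mem_insert]
    rintro w (rfl | rfl | hw)
    · simpa using h.adj_cz.ne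
    · simpa using h.adj_cz
    · exact iff_of_false (h.not_adj_c w hw) (by rintro rfl; exact h.z_notMem hw)
  have h4 := h2.erase_leaf h3
  rwa [erase_insert] at h4
  exact fun h' => h.notMem_c (mem_insert_of_mem h')

end IsPendant

variable [DecidableRel G.Adj]

lemma nbrsIn_insert_self (z : V) : nbrsIn G (insert z B) z = nbrsIn G B z := by
  ext w
  simp only [mem_nbrsIn, mem_insert]
  exact ⟨fun h => ⟨h.1.resolve_left h.2.ne', h.2⟩, fun h => ⟨Or.inr h.1, h.2⟩⟩

/-- If deleting `z` from a tree leaves only components with at most two vertices, then every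
component contains a neighbour of `z`. -/
lemma IsTreeOn.exists_common_nbr (hT : IsTreeOn G A) {z : V} (hz : z ∈ A)
    (hd : IsDissoc G (A.erase z)) {v : V} (hv : v ∈ A) (hvz : v ≠ z) (hzv : ¬ G.Adj z v) :
    ∃ w ∈ nbrsIn G A z, G.Adj w v := by
  by_contra hno
  push Not at hno
  have hvz' : v ∈ A.erase z := mem_erase.2 ⟨hvz, hv⟩
  obtain ⟨u, hu, x, hx, hxC, hux⟩ := hT.exists_adj_of_ne
    (C := insert v (nbrsIn G (A.erase z) v))
    (insert_subset hv ((nbrsIn_subset _ _).trans (erase_subset _ _))) (insert_nonempty _ _)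
    (fun h => by
      have := h.symm ▸ hz
      simp [hvz.symm] at this)
  simp only [mem_insert, mem_nbrsIn, mem_erase, not_or, not_and] at hu hxC
  rcases hu with rfl | ⟨⟨huz, huA⟩, hvu⟩
  · refine hxC.2 ⟨?_, hx⟩ hux
    rintro rfl
    exact hzv hux.symm
  · have hxz : x ≠ z := by
      rintro rfl
      exact hno u (mem_nbrsIn.2 ⟨huA, hux.symm⟩) hvu.symm
    exact not_isDissoc_of_two (mem_erase.2 ⟨huz, huA⟩) hvz' (mem_erase.2 ⟨hxz, hx⟩) hvu.symm hux
      (Ne.symm hxC.1) hd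

/-- Each neighbour of the centre `z` accounts for at most two vertices. -/
lemma IsTreeOn.card_le_of_isDissoc_erase (hT : IsTreeOn G A) {z : V} (hz : z ∈ A)
    (hd : IsDissoc G (A.erase z)) : #A ≤ 2 * #(nbrsIn G A z) + 1 := by
  have hsub : A.erase z ⊆
      nbrsIn G A z ∪ (nbrsIn G A z).biUnion fun w => nbrsIn G (A.erase z) w := by
    intro v hv
    obtain ⟨hvz, hvA⟩ := mem_erase.1 hv
    by_cases hzv : G.Adj z v
    · exact mem_union_left _ (mem_nbrsIn.2 ⟨hvA, hzv⟩)
    · obtain ⟨w, hw, hwv⟩ := hT.exists_common_nbr hz hd hvA hvz hzv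
      exact mem_union_right _ (mem_biUnion.2 ⟨w, hw, mem_nbrsIn.2 ⟨hv, hwv⟩⟩)
  have h1 := (card_le_card hsub).trans (card_union_le _ _)
  have h2 : #((nbrsIn G A z).biUnion fun w => nbrsIn G (A.erase z) w) ≤ #(nbrsIn G A z) * 1 := by
    refine card_biUnion_le_card_mul _ _ _ fun w hw => hd w ?_
    rw [mem_nbrsIn] at hw
    exact mem_erase.2 ⟨hw.2.ne', hw.1⟩
  rw [card_erase_of_mem hz] at h1
  omega

namespace IsPendant

variable {p c z : V}

lemma numDissoc_eq (h : IsPendant G B p c z) :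
    numDissoc G (insert c (insert p (insert z B))) =
      2 * numDissoc G (insert z B) + 2 * numDissoc G B + numDissoc G (B \ nbrsIn G B z) :=
  numDissoc_pendant h.p_notMem h.c_notMem h.z_notMem h.adj_pc h.adj_cz h.p_ne_z h.not_adj_pz
    h.not_adj_p h.not_adj_c

lemma card_nbrsIn (h : IsPendant G B p c z) :
    #(nbrsIn G (insert c (insert p (insert z B))) z) = #(nbrsIn G B z) + 1 := by
  have : nbrsIn G (insert c (insert p (insert z B))) z = insert c (nbrsIn G B z) := by
    ext w
    simp only [mem_nbrsIn, mem_insert]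
    constructor
    · rintro ⟨rfl | rfl | rfl | hw, h'⟩
      · exact Or.inl rfl
      · exact absurd h'.symm h.not_adj_pz
      · exact absurd h' (G.loopless.irrefl _)
      · exact Or.inr ⟨hw, h'⟩
    · rintro (rfl | ⟨hw, h'⟩)
      · exact ⟨Or.inl rfl, h.adj_cz.symm⟩
      · exact ⟨Or.inr (Or.inr (Or.inr hw)), h'⟩
  rw [this, card_insert_of_notMem]
  simp [h.c_notMem]

lemma isDissoc_erase (h : IsPendant G B p c z) (hB : IsDissoc G B) :
    IsDissoc G ((insert c (insert p (insert z B))).erase z) := by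
  rw [erase_insert_of_ne h.adj_cz.ne, erase_insert_of_ne h.p_ne_z, erase_insert h.z_notMem]
  have : insert c (insert p B) = B ∪ {c, p} := by
    ext a; simp only [mem_insert, mem_union, mem_singleton]; tauto
  rw [this, isDissoc_union_iff (isDissoc_of_card_le_two card_le_two)]
  · exact hB
  · simp only [mem_insert, mem_singleton]
    rintro u (rfl | rfl)
    · exact h.not_adj_c
    · exact h.not_adj_p

end IsPendant

lemma IsLeafAt.exists_isPendant {p c : V} (hp : IsLeafAt G A p c)
    (hc : #(nbrsIn G A c) = 2) :
    ∃ z B, IsPendant G B p c z ∧ A = insert c (insert p (insert z B)) := by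
  have hpN : p ∈ nbrsIn G A c := mem_nbrsIn.2 ⟨hp.1, hp.adj.symm⟩
  obtain ⟨z, hz⟩ := card_eq_one.1 (show #((nbrsIn G A c).erase p) = 1 by
    rw [card_erase_of_mem hpN, hc])
  have hmem : ∀ v, v ≠ p ∧ v ∈ A ∧ G.Adj c v ↔ v = z := by
    intro v
    rw [← mem_singleton, ← hz, mem_erase, mem_nbrsIn]
  obtain ⟨hzp, hzA, hcz⟩ := (hmem z).2 rfl
  refine ⟨z, ((A.erase c).erase p).erase z, ⟨by simp, by simp, by simp, hp.adj, hcz, hzp.symm,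
    ?_, ?_, ?_⟩, ?_⟩
  · exact fun h => hcz.ne' ((hp.2.2 z hzA).1 h)
  · intro v hv h
    simp only [mem_erase] at hv
    exact hv.2.2.1 ((hp.2.2 v hv.2.2.2).1 h)
  · intro v hv h
    simp only [mem_erase] at hv
    exact hv.1 ((hmem v).1 ⟨hv.2.1, hv.2.2.2, h⟩)
  · rw [insert_erase, insert_erase, insert_erase hp.2.1]
    · exact mem_erase.2 ⟨hp.adj.ne, hp.1⟩
    · simp [hzp, hzA, hcz.ne']

/-- `G[A]` is a subdivided star with at most one unsubdivided edge: deleting the centre `z` leaves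
components with at most two vertices, and at most one of them is a single vertex. -/
def IsSpiderOn (G : SimpleGraph V) [DecidableRel G.Adj] (A : Finset V) : Prop :=
  ∃ z ∈ A, IsDissoc G (A.erase z) ∧ 2 * #(nbrsIn G A z) ≤ #A

/-- `G[A]` is a path with six vertices. -/
def IsPathSixOn (G : SimpleGraph V) (A : Finset V) : Prop :=
  ∃ φ : SimpleGraph.pathGraph 6 ↪g G, A = univ.map φ.toEmbedding

/-- Spiders attain the bound: removing a leg of length two is an instance of the recursion at a
pendant path, in which all three summands are known. -/
lemma IsSpiderOn.numDissoc_eq (hT : IsTreeOn G A) (h : IsSpiderOn G A) :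
    numDissoc G A = 2 ^ (#A - 1) + excess #A := by
  induction hn : #A using Nat.strong_induction_on generalizing A with
  | _ n ih =>
    subst hn
    obtain ⟨z, hz, hd, hk⟩ := h
    by_cases hex : ∃ c ∈ nbrsIn G A z, ∃ p ∈ A, p ≠ z ∧ G.Adj c p
    · obtain ⟨c, hcN, p, hpA, hpz, hcp⟩ := hex
      obtain ⟨hcA, hzc⟩ := mem_nbrsIn.1 hcN
      have hc' : c ∈ A.erase z := mem_erase.2 ⟨hzc.ne', hcA⟩
      have hp' : p ∈ A.erase z := mem_erase.2 ⟨hpz, hpA⟩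
      obtain ⟨B, hB⟩ : ∃ B, B = ((A.erase c).erase p).erase z := ⟨_, rfl⟩
      have hBmem : ∀ v ∈ B, v ≠ c ∧ v ≠ p ∧ v ∈ A.erase z := by
        intro v hv
        simp only [hB, mem_erase] at hv ⊢
        tauto
      have hpen : IsPendant G B p c z := by
        refine ⟨by simp [hB], by simp [hB], by simp [hB], hcp.symm, hzc.symm, hpz, ?_, ?_, ?_⟩
        · exact fun h => hT.no_triangle hz hcA hpA hzc hcp h.symm
        · exact fun v hv h => not_isDissoc_of_two hp' hc' (hBmem v hv).2.2 hcp.symm h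
            (hBmem v hv).1.symm hd
        · exact fun v hv h => not_isDissoc_of_two hc' hp' (hBmem v hv).2.2 hcp h
            (hBmem v hv).2.1.symm hd
      have hA : A = insert c (insert p (insert z B)) := by
        rw [hB, insert_erase, insert_erase, insert_erase hcA]
        · exact mem_erase.2 ⟨hcp.ne', hpA⟩
        · simp [hpz.symm, hz, hzc.ne]
      have hBd : IsDissoc G B := hd.mono fun v hv => (hBmem v hv).2.2
      rw [hA] at hk hT ih
      rw [hA]
      have hT' := hpen.isTreeOn hT
      rw [hpen.card_nbrsIn, hpen.card_eq] at hk
      rw [hpen.card_eq] at ih ⊢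
      have hcard : #(insert z B) = #B + 1 := card_insert_of_notMem hpen.z_notMem
      have hsp := hT'.card_le_of_isDissoc_erase (mem_insert_self z B)
        (by rwa [erase_insert hpen.z_notMem])
      rw [nbrsIn_insert_self, hcard] at hsp
      have h1 := ih (#B + 1) (by omega) hT' ⟨z, mem_insert_self _ _,
        by rwa [erase_insert hpen.z_notMem], by rw [nbrsIn_insert_self]; omega⟩ hcard
      rw [hpen.numDissoc_eq, h1, numDissoc_eq_of_isDissoc hBd,
        numDissoc_eq_of_isDissoc (hBd.mono sdiff_subset), card_sdiff_of_subset (nbrsIn_subset _ _),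
        excess_add_three, show #B - #(nbrsIn G B z) = #B / 2 by omega,
        show #B + 3 - 1 = #B + 2 by omega, show #B + 1 - 1 = #B by omega]
      ring
    · push Not at hex
      -- all vertices other than `z` are leaves, and there is at most one
      have hsub : A ⊆ insert z (nbrsIn G A z) := by
        intro v hv
        by_contra hv'
        rw [mem_insert, not_or] at hv'
        obtain ⟨w, hw, hwv⟩ := hT.exists_common_nbr hz hd hv hv'.1
          fun h => hv'.2 (mem_nbrsIn.2 ⟨hv, h⟩)
        exact hex w hw v hv hv'.1 hwv
      have h1 := (card_le_card hsub).trans (card_insert_le _ _)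
      have h2 : 0 < #A := card_pos.2 ⟨z, hz⟩
      rw [numDissoc_eq_of_isDissoc (isDissoc_of_card_le_two (by omega))]
      obtain h | h : #A = 1 ∨ #A = 2 := by omega
      all_goals rw [h]; rfl

end

/-! ### The upper bound -/

section
open Finset

variable {V : Type*} [DecidableEq V] {G : SimpleGraph V} {A B : Finset V}

/-- A pendant path whose end `z` is attached to an end of the path `w₁ - w - w₂`. -/
lemma IsPendant.isPathSixOn {p c z w w₁ w₂ : V} (h : IsPendant G B p c z) (hB : B = {w, w₁, w₂})
    (h1 : G.Adj w w₁) (h2 : G.Adj w w₂) (h12 : w₁ ≠ w₂) (hn : ¬ G.Adj w₁ w₂)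
    (hz1 : G.Adj z w₁) (hzw : ¬ G.Adj z w) (hz2 : ¬ G.Adj z w₂) :
    IsPathSixOn G (insert c (insert p (insert z B))) := by
  subst hB
  obtain ⟨hp, hc, hz, hpc, hcz, hpz, hpz', hpB, hcB⟩ := h
  simp only [mem_insert, mem_singleton, not_or, forall_eq_or_imp, forall_eq] at hp hc hz hpB hcB
  have hinj : Function.Injective ![p, c, z, w₁, w, w₂] := by
    have e1 := hpc.ne
    have e2 := hcz.ne
    have e3 := h1.ne'
    have e4 := h2.ne
    intro i j hij
    fin_cases i <;> fin_cases j <;> first | rfl | (exfalso; simp at hij; grind)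
  refine ⟨⟨⟨_, hinj⟩, ?_⟩, ?_⟩
  · intro i j
    rw [SimpleGraph.pathGraph_adj]
    fin_cases i <;> fin_cases j <;> simp [*, G.adj_comm]
  · ext a
    simp [Fin.exists_fin_succ]
    grind

variable [DecidableRel G.Adj]

/-- `G[A]` has at most `f(#A)` dissociation sets, and exactly so many only if it is one of the
extremal trees. -/
def SatisfiesBound (G : SimpleGraph V) [DecidableRel G.Adj] (A : Finset V) : Prop :=
  numDissoc G A ≤ 2 ^ (#A - 1) + excess #A ∧
    (numDissoc G A = 2 ^ (#A - 1) + excess #A → IsSpiderOn G A ∨ IsPathSixOn G A)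

lemma numDissoc_sdiff_le (N : Finset V) (hN : N ⊆ B) : numDissoc G (B \ N) ≤ 2 ^ (#B - #N) :=
  (numDissoc_le _).trans (by rw [card_sdiff_of_subset hN])

/-- If `z` has degree two, then `B` is a tree as well, and its bound limits the number of sets that
contain `c` but not `z`. -/
lemma IsPendant.satisfiesBound_of_card_eq_one {p c z : V} (h : IsPendant G B p c z)
    (hT : IsTreeOn G (insert z B)) (hzB : SatisfiesBound G (insert z B))
    (ih : IsTreeOn G B → SatisfiesBound G B) (hd : ¬ IsDissoc G B) (hk : #(nbrsIn G B z) = 1) :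
    SatisfiesBound G (insert c (insert p (insert z B))) := by
  obtain ⟨v, hv⟩ := card_eq_one.1 hk
  have hvmem : ∀ w, w ∈ B ∧ G.Adj z w ↔ w = v := by
    intro w; rw [← mem_nbrsIn, hv, mem_singleton]
  obtain ⟨hvB, hzv⟩ := (hvmem v).2 rfl
  have hleaf : IsLeafAt G (insert z B) z v := by
    refine ⟨mem_insert_self _ _, mem_insert_of_mem hvB, fun w hw => ?_⟩
    rcases mem_insert.1 hw with rfl | hw
    · simpa using hzv.ne
    · rw [← hvmem]; exact (and_iff_right hw).symm
  have hTB : IsTreeOn G B := by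
    have := hT.erase_leaf hleaf
    rwa [erase_insert h.z_notMem] at this
  have hcard : #(insert z B) = #B + 1 := card_insert_of_notMem h.z_notMem
  have hN := numDissoc_sdiff_le (G := G) _ (nbrsIn_subset (G := G) B z)
  have hB1 := (ih hTB).1
  have hzB1 := hzB.1
  obtain ⟨w, hw, w₁, hw₁, w₂, hw₂, h1, h2, h12⟩ := exists_two_of_not_isDissoc hd
  have hw3 : ({w, w₁, w₂} : Finset V) ⊆ B := by
    simp [insert_subset_iff, hw, hw₁, hw₂]
  have h3 : #({w, w₁, w₂} : Finset V) = 3 := by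
    rw [card_insert_of_notMem, card_pair h12]
    simp [h1.ne, h2.ne]
  have hb3 : 3 ≤ #B := h3 ▸ card_le_card hw3
  unfold SatisfiesBound
  rw [h.numDissoc_eq, h.card_eq, excess_add_three]
  rw [hk] at hN
  rw [hcard] at hzB1
  rw [show #B + 3 - 1 = #B + 2 by omega]
  rw [show #B + 1 - 1 = #B by omega] at hzB1
  obtain ⟨k, hk'⟩ : ∃ k, #B = k + 1 := ⟨#B - 1, by omega⟩
  rcases Nat.lt_or_ge 3 #B with hb | hb
  · have := two_mul_excess_lt (k := k) (by omega)
    rw [hk'] at hzB1 hB1 hN ⊢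
    simp only [Nat.add_sub_cancel] at hB1 hN
    have e1 : 2 ^ (k + 1) = 2 * 2 ^ k := by ring
    have e2 : 2 ^ (k + 1 + 2) = 8 * 2 ^ k := by ring
    rw [e2]
    rw [e1] at hzB1
    constructor
    · omega
    · intro; omega
  · have hb' : #B = 3 := by omega
    have hBeq := (eq_of_subset_of_card_le hw3 (by omega)).symm
    rw [hb'] at hzB1 hB1 hN hcard ⊢
    norm_num [excess] at hzB1 hB1 hN ⊢
    refine ⟨by omega, fun heq => Or.inr ?_⟩
    have hn : ¬ G.Adj w₁ w₂ := fun h' => hTB.no_triangle hw hw₁ hw₂ h1 h' h2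
    have hne : ∀ u ∈ B, u ≠ v → ¬ G.Adj z u := fun u hu huv h' => huv ((hvmem u).1 ⟨hu, h'⟩)
    have hv3 : v = w ∨ v = w₁ ∨ v = w₂ := by
      have := hBeq ▸ hvB
      simpa using this
    rcases hv3 with rfl | rfl | rfl
    · -- otherwise the tree on `insert z B` is a star with three leaves, which is not extremal
      exfalso
      have := hzB.2 (by rw [hcard]; norm_num [excess]; omega)
      rcases this with ⟨u, hu, hud, huk⟩ | ⟨φ, hφ⟩
      · rw [hcard] at huk
        have hz1 : z ≠ w₁ := by rintro rfl; exact h.z_notMem hw₁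
        have hz2 : z ≠ w₂ := by rintro rfl; exact h.z_notMem hw₂
        by_cases huv : u = v
        · have : ({z, w₁, w₂} : Finset V) ⊆ nbrsIn G (insert z B) u := by
            subst huv
            intro a
            simp only [mem_insert, mem_singleton, mem_nbrsIn]
            rintro (rfl | rfl | rfl)
            · exact ⟨Or.inl rfl, hzv.symm⟩
            · exact ⟨Or.inr hw₁, h1⟩
            · exact ⟨Or.inr hw₂, h2⟩
          have := card_le_card this
          rw [card_insert_of_notMem (by simp [hz1, hz2]), card_pair h12] at this
          omega
        · have hvu : v ∈ (insert z B).erase u :=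
            mem_erase.2 ⟨Ne.symm huv, mem_insert_of_mem hvB⟩
          have hmem : ∀ {a}, a ∈ insert z B → a ≠ u → a ∈ (insert z B).erase u :=
            fun ha hau => mem_erase.2 ⟨hau, ha⟩
          by_cases hu1 : w₁ = u
          · exact not_isDissoc_of_two hvu (hmem (mem_insert_self z B) (hu1 ▸ hz1))
              (hmem (mem_insert_of_mem hw₂) (hu1 ▸ h12.symm)) hzv.symm h2 hz2 hud
          · by_cases hu2 : w₂ = u
            · exact not_isDissoc_of_two hvu (hmem (mem_insert_self z B) (hu2 ▸ hz2))
                (hmem (mem_insert_of_mem hw₁) (hu2 ▸ h12)) hzv.symm h1 hz1 hud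
            · exact not_isDissoc_of_two hvu (hmem (mem_insert_of_mem hw₁) hu1)
                (hmem (mem_insert_of_mem hw₂) hu2) h1 h2 h12 hud
      · rw [hφ, card_map, card_univ, Fintype.card_fin] at hcard
        omega
    · exact h.isPathSixOn hBeq h1 h2 h12 hn hzv (hne w hw h1.ne) (hne w₂ hw₂ h12.symm)
    · exact h.isPathSixOn (by rw [hBeq, pair_comm]) h2 h1 h12.symm (fun h' => hn h'.symm) hzv
        (hne w hw h2.ne) (hne w₁ hw₁ h12)

/-- The induction step at a pendant path `p - c - z`. -/
lemma IsPendant.satisfiesBound {p c z : V} (h : IsPendant G B p c z)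
    (hT : IsTreeOn G (insert z B)) (hzB : SatisfiesBound G (insert z B))
    (ih : IsTreeOn G B → SatisfiesBound G B) :
    SatisfiesBound G (insert c (insert p (insert z B))) := by
  have hcard : #(insert z B) = #B + 1 := card_insert_of_notMem h.z_notMem
  have hN := numDissoc_sdiff_le (G := G) _ (nbrsIn_subset (G := G) B z)
  have hzB1 := hzB.1
  rw [hcard, show #B + 1 - 1 = #B by omega] at hzB1
  have e2 : 2 ^ (#B + 2) = 4 * 2 ^ #B := by ring
  by_cases hd : IsDissoc G B
  · have hsp := hT.card_le_of_isDissoc_erase (mem_insert_self z B)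
      (by rwa [erase_insert h.z_notMem])
    rw [nbrsIn_insert_self, hcard] at hsp
    have hle : 2 ^ (#B - #(nbrsIn G B z)) ≤ 2 ^ (#B / 2) :=
      Nat.pow_le_pow_right two_pos (by omega)
    have hB := numDissoc_le (G := G) B
    unfold SatisfiesBound
    rw [h.numDissoc_eq, h.card_eq, excess_add_three, show #B + 3 - 1 = #B + 2 by omega, e2]
    refine ⟨by omega, fun heq => Or.inl ⟨z, by simp, h.isDissoc_erase hd, ?_⟩⟩
    have hge : 2 ^ (#B / 2) ≤ 2 ^ (#B - #(nbrsIn G B z)) := by omega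
    have := (Nat.pow_le_pow_iff_right (by norm_num)).1 hge
    have := card_le_card (nbrsIn_subset (G := G) B z)
    rw [h.card_nbrsIn, h.card_eq]
    omega
  · have hB := numDissoc_add_le hd
    obtain ⟨w, hw, -⟩ := exists_two_of_not_isDissoc hd
    have hpos : 0 < #B := card_pos.2 ⟨w, hw⟩
    have hN0 : 0 < #(nbrsIn G B z) := by
      obtain ⟨u, hu, hzu⟩ := hT.exists_adj (by omega) (mem_insert_self z B)
      rw [← nbrsIn_insert_self]
      exact card_pos.2 ⟨u, mem_nbrsIn.2 ⟨hu, hzu⟩⟩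
    by_cases hk1 : #(nbrsIn G B z) = 1
    · exact h.satisfiesBound_of_card_eq_one hT hzB ih hd hk1
    · have hle : 2 ^ (#B - #(nbrsIn G B z)) ≤ 2 * 2 ^ (#B - 3) := by
        rw [← pow_succ']
        exact Nat.pow_le_pow_right two_pos (by omega)
      have := Nat.two_pow_pos (#B / 2)
      unfold SatisfiesBound
      rw [h.numDissoc_eq, h.card_eq, excess_add_three, show #B + 3 - 1 = #B + 2 by omega, e2]
      constructor
      · omega
      · intro; omega

/-- A tree with two leaves `x`, `y` at a common neighbour `v` of degree at least three is never
extremal. -/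
lemma IsTreeOn.numDissoc_lt_of_twins (hT : IsTreeOn G A) (hA : 4 ≤ #A) {x y v : V}
    (hx : IsLeafAt G A x v) (hy : IsLeafAt G A y v) (hxy : x ≠ y) (hv : #(nbrsIn G A v) ≠ 2)
    (ih : ∀ B, #B < #A → IsTreeOn G B → SatisfiesBound G B) :
    numDissoc G A < 2 ^ (#A - 1) + excess #A := by
  obtain ⟨M', hM'⟩ : ∃ M', M' = ((A.erase x).erase y).erase v := ⟨_, rfl⟩
  have hvx := hx.adj.ne'
  have hvy := hy.adj.ne'
  have hM'mem : ∀ w ∈ M', w ≠ v ∧ w ≠ y ∧ w ≠ x ∧ w ∈ A := by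
    intro w hw
    simpa only [hM', mem_erase] using hw
  have hTxy : IsTreeOn G ((A.erase x).erase y) :=
    (hT.erase_leaf hx).erase_leaf (hy.mono (erase_subset _ _) (mem_erase.2 ⟨hxy.symm, hy.1⟩)
      (mem_erase.2 ⟨hvx, hx.2.1⟩))
  have hins : insert v M' = (A.erase x).erase y := by
    rw [hM', insert_erase]
    simp [hvx, hvy, hx.2.1]
  rw [← hins] at hTxy
  have hvM' : v ∉ M' := by simp [hM']
  have hyM' : y ∉ M' := by simp [hM']
  have hxM' : x ∉ M' := by simp [hM']
  have hvM : v ∉ insert y M' := by simp [hvM', hvy]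
  have hxM : x ∉ insert y M' := by simp [hxM', hxy]
  have hinsx : insert v (insert y M') = A.erase x := by
    rw [Finset.insert_comm, hins, insert_erase]
    simp [hxy.symm, hy.1]
  have hAeq : A = insert x (insert v (insert y M')) := by rw [hinsx, insert_erase hx.1]
  have hcA : #A = #M' + 3 := by
    rw [hAeq, card_insert_of_notMem, card_insert_of_notMem hvM, card_insert_of_notMem hyM']
    simp [hvx.symm, hxM]
  have hcM : #(insert y M') = #M' + 1 := card_insert_of_notMem hyM'
  have hnbr : nbrsIn G (insert y M') v = insert y (nbrsIn G M' v) := by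
    ext w
    simp only [mem_nbrsIn, mem_insert]
    constructor
    · rintro ⟨rfl | h, h'⟩
      · exact Or.inl rfl
      · exact Or.inr ⟨h, h'⟩
    · rintro (rfl | h)
      · exact ⟨Or.inl rfl, hy.adj.symm⟩
      · exact ⟨Or.inr h.1, h.2⟩
  have hcN : #(nbrsIn G (insert y M') v) = #(nbrsIn G M' v) + 1 := by
    rw [hnbr, card_insert_of_notMem]
    simp [hyM']
  have hdeg : #(nbrsIn G A v) = #(nbrsIn G M' v) + 2 := by
    have : nbrsIn G A v = insert x (nbrsIn G (insert y M') v) := by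
      rw [hAeq]
      ext w
      simp only [mem_nbrsIn, mem_insert]
      constructor
      · rintro ⟨rfl | rfl | h, h'⟩
        · exact Or.inl rfl
        · exact absurd h' (G.loopless.irrefl _)
        · exact Or.inr ⟨h, h'⟩
      · rintro (rfl | h)
        · exact ⟨Or.inl rfl, hx.adj.symm⟩
        · exact ⟨Or.inr (Or.inr h.1), h.2⟩
    rw [this, card_insert_of_notMem, hcN]
    simpa [hxy] using fun h => absurd h hxM'
  have hrec := numDissoc_leaf hxM hvM hx.adj fun w hw h => hvM <| by
    have hwA : w ∈ A := by rw [hAeq]; exact mem_insert_of_mem (mem_insert_of_mem hw)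
    rwa [(hx.2.2 w hwA).1 h] at hw
  rw [← hAeq, hinsx] at hrec
  have h1 := (ih (A.erase x) (card_erase_lt_of_mem hx.1) (hT.erase_leaf hx)).1
  have h3 := numDissoc_sdiff_le (G := G) _ (nbrsIn_subset (G := G) (insert y M') v)
  rw [card_erase_of_mem hx.1, hcA] at h1
  rw [hcM, hcN] at h3
  rw [hcA]
  obtain ⟨k, hk⟩ : ∃ k, #M' = k + 1 := ⟨#M' - 1, by omega⟩
  rw [hk] at h1 h3 ⊢
  simp only [show k + 3 - 1 = k + 2 by omega, show k + 1 + 3 - 1 = k + 3 by omega,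
    show k + 1 + 3 = k + 4 by omega, show k + 1 + 1 = k + 2 by omega] at h1 h3 ⊢
  have e2 : 2 ^ (k + 2) = 4 * 2 ^ k := by ring
  have e3 : 2 ^ (k + 3) = 8 * 2 ^ k := by ring
  rw [e2] at h1
  rw [e3]
  have hlt := excess_add_lt k
  by_cases hd : IsDissoc G (insert y M')
  · have hsp := hTxy.card_le_of_isDissoc_erase (mem_insert_self v M')
      (by rw [erase_insert hvM']; exact hd.mono (subset_insert _ _))
    rw [nbrsIn_insert_self, card_insert_of_notMem hvM'] at hsp
    have hle : 2 ^ (k + 2 - (#(nbrsIn G M' v) + 1)) ≤ 2 ^ ((k + 1) / 2) :=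
      Nat.pow_le_pow_right two_pos (by omega)
    have h2 := numDissoc_le (G := G) (insert y M')
    rw [hcM, hk, show k + 1 + 1 = k + 2 by omega, e2] at h2
    omega
  · by_cases hj : #(nbrsIn G M' v) = 1
    · obtain ⟨w, hw⟩ := card_eq_one.1 hj
      have hwmem : ∀ u, u ∈ M' ∧ G.Adj v u ↔ u = w := by
        intro u; rw [← mem_nbrsIn, hw, mem_singleton]
      have hleaf : IsLeafAt G (insert v M') v w := by
        refine ⟨mem_insert_self _ _, mem_insert_of_mem ((hwmem w).2 rfl).1, fun u hu => ?_⟩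
        rcases mem_insert.1 hu with rfl | hu
        · simpa using ((hwmem w).2 rfl).2.ne
        · rw [← hwmem]; exact (and_iff_right hu).symm
      have hTM' := hTxy.erase_leaf hleaf
      rw [erase_insert hvM'] at hTM'
      have h2 := (ih M' (by omega) hTM').1
      have h2' : numDissoc G (insert y M') = 2 * numDissoc G M' :=
        numDissoc_insert_isolated hyM' fun u hu h =>
          (hM'mem u hu).1 ((hy.2.2 u (hM'mem u hu).2.2.2).1 h)
      rw [hk, Nat.add_sub_cancel] at h2
      rw [hj, show k + 2 - (1 + 1) = k by omega] at h3
      have := two_mul_excess_add_lt k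
      omega
    · have hN0 : #(nbrsIn G M' v) ≠ 0 := by omega
      have h2 := numDissoc_add_le hd
      rw [hcM, hk, show k + 1 + 1 = k + 2 by omega, e2] at h2
      have hle : 2 ^ (k + 2 - (#(nbrsIn G M' v) + 1)) ≤ 2 ^ (k + 2 - 3) :=
        Nat.pow_le_pow_right two_pos (by omega)
      have := Nat.two_pow_pos ((k + 1) / 2)
      omega

/-- The upper bound together with the description of the trees attaining it. -/
theorem IsTreeOn.satisfiesBound (hT : IsTreeOn G A) : SatisfiesBound G A := by
  induction hn : #A using Nat.strong_induction_on generalizing A with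
  | _ n ih =>
    subst hn
    have hne : ∃ z, z ∈ A := by
      cases hT with
      | single v => exact ⟨v, mem_singleton_self v⟩
      | leaf => exact ⟨_, mem_insert_self _ _⟩
    obtain ⟨z, hz⟩ := hne
    have hpos : 0 < #A := card_pos.2 ⟨z, hz⟩
    rcases Nat.lt_or_ge 2 #A with h2 | h2
    · have hpendant : ∀ p c, IsLeafAt G A p c → #(nbrsIn G A c) = 2 → SatisfiesBound G A := by
        intro p c hp hc
        obtain ⟨z, B, hB, rfl⟩ := hp.exists_isPendant hc
        have hTz := hB.isTreeOn hT
        rw [hB.card_eq] at ih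
        have hcard : #(insert z B) = #B + 1 := card_insert_of_notMem hB.z_notMem
        exact hB.satisfiesBound hTz (ih _ (by omega) hTz rfl)
          fun hTB => ih _ (by omega) hTB rfl
      obtain ⟨p, c, hp, h⟩ := hT.exists_leaf h2
      by_cases hc : #(nbrsIn G A c) = 2
      · exact hpendant p c hp hc
      · obtain ⟨q, hqp, hq⟩ := h.resolve_left hc
        have h4 : 4 ≤ #A := by
          by_contra hlt
          -- on three vertices, the common neighbour of two leaves has degree two
          have hle : #(nbrsIn G A c) ≤ #(A.erase c) := card_le_card fun w hw => by
            rw [mem_nbrsIn] at hw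
            exact mem_erase.2 ⟨hw.2.ne', hw.1⟩
          rw [card_erase_of_mem hp.2.1] at hle
          have hge : #({p, q} : Finset V) ≤ #(nbrsIn G A c) := by
            refine card_le_card fun w hw => ?_
            rcases mem_insert.1 hw with rfl | hw
            · exact mem_nbrsIn.2 ⟨hp.1, hp.adj.symm⟩
            · rw [mem_singleton] at hw
              subst hw
              exact mem_nbrsIn.2 ⟨hq.1, hq.adj.symm⟩
          rw [card_pair hqp.symm] at hge
          omega
        have := hT.numDissoc_lt_of_twins h4 hp hq hqp.symm hc fun B hB hTB => ih _ hB hTB rfl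
        exact ⟨this.le, fun h => absurd h this.ne⟩
    · have hd : IsDissoc G (A.erase z) :=
        isDissoc_of_card_le_two ((card_le_card (erase_subset _ _)).trans h2)
      have hk : #(nbrsIn G A z) ≤ #A - 1 := by
        rw [← card_erase_of_mem hz]
        refine card_le_card fun w hw => ?_
        rw [mem_nbrsIn] at hw
        exact mem_erase.2 ⟨hw.2.ne', hw.1⟩
      have hs : IsSpiderOn G A := ⟨z, hz, hd, by omega⟩
      exact ⟨(hs.numDissoc_eq hT).le, fun _ => Or.inl hs⟩

end

/-! ### Translation to the original graph -/

section
open Finset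

lemma numDissociationSets_eq {V : Type*} [Fintype V] [DecidableEq V] (G : SimpleGraph V)
    [DecidableRel G.Adj] : numDissociationSets G = numDissoc G univ := by
  have key : ∀ S : Finset V, IsDissociationSet G (S : Set V) ↔ IsDissoc G S := by
    intro S
    have h : ∀ v : (S : Set V), ((G.induce (S : Set V)).neighborSet v).encard =
        #(nbrsIn G S v) := by
      intro v
      rw [← Subtype.val_injective.encard_image, ← Set.encard_coe_eq_coe_finsetCard]
      congr 1
      ext w
      simp only [Set.mem_image, SimpleGraph.mem_neighborSet, SimpleGraph.comap_adj, mem_coe,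
        mem_nbrsIn, Function.Embedding.subtype_apply]
      exact ⟨fun ⟨u, hu, huw⟩ => huw ▸ ⟨u.2, hu⟩, fun hw => ⟨⟨w, hw.1⟩, hw.2, rfl⟩⟩
    unfold IsDissociationSet IsDissoc
    simp only [h]
    exact ⟨fun H v hv => by exact_mod_cast H ⟨v, hv⟩, fun H v => by exact_mod_cast H v v.2⟩
  have : {S : Set V | IsDissociationSet G S} =
      (fun S : Finset V => (S : Set V)) '' ({S ∈ univ.powerset | IsDissoc G S} : Finset _) := by
    ext S
    simp only [Set.mem_ofPred_eq, coe_filter, Set.mem_image, mem_powerset, subset_univ, true_and]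
    constructor
    · intro hS
      refine ⟨S.toFinite.toFinset, ?_, S.toFinite.coe_toFinset⟩
      rwa [← key, S.toFinite.coe_toFinset]
    · rintro ⟨S, hS, rfl⟩
      exact (key S).2 hS
  rw [numDissociationSets, this, Set.ncard_image_of_injective _ coe_injective,
    Set.ncard_coe_finset, numDissoc]

/-! ### Isomorphism invariance and the extremal graphs -/

section map

variable {V W : Type*} {G : SimpleGraph V} {H : SimpleGraph W} [DecidableRel G.Adj]
  [DecidableRel H.Adj] (φ : G ↪g H) (A : Finset V)

lemma nbrsIn_map (v : V) :
    nbrsIn H (A.map φ.toEmbedding) (φ v) = (nbrsIn G A v).map φ.toEmbedding := by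
  ext w
  simp only [mem_nbrsIn, mem_map]
  constructor
  · rintro ⟨⟨u, hu, rfl⟩, h⟩
    exact ⟨u, ⟨hu, φ.map_adj_iff.1 h⟩, rfl⟩
  · rintro ⟨u, ⟨hu, h⟩, rfl⟩
    exact ⟨⟨u, hu, rfl⟩, φ.map_adj_iff.2 h⟩

lemma isDissoc_map : IsDissoc H (A.map φ.toEmbedding) ↔ IsDissoc G A := by
  unfold IsDissoc
  rw [forall_mem_map]
  refine forall₂_congr fun v _ => ?_
  rw [show φ.toEmbedding v = φ v from rfl, nbrsIn_map, card_map]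

lemma numDissoc_map : numDissoc H (A.map φ.toEmbedding) = numDissoc G A := by
  unfold numDissoc
  symm
  refine card_bij (fun S _ => S.map φ.toEmbedding) ?_ ?_ ?_
  · intro S hS
    rw [mem_filter, mem_powerset] at hS ⊢
    exact ⟨map_subset_map.2 hS.1, (isDissoc_map φ S).2 hS.2⟩
  · intro S _ T _ h
    exact map_injective _ h
  · intro S hS
    rw [mem_filter, mem_powerset] at hS
    obtain ⟨T, hT, rfl⟩ := subset_map_iff.1 hS.1
    exact ⟨T, mem_filter.2 ⟨mem_powerset.2 hT, (isDissoc_map φ T).1 hS.2⟩, rfl⟩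

lemma IsSpiderOn.map [DecidableEq V] [DecidableEq W] {A : Finset V} (h : IsSpiderOn G A) :
    IsSpiderOn H (A.map φ.toEmbedding) := by
  obtain ⟨z, hz, hd, hk⟩ := h
  refine ⟨φ z, mem_map_of_mem _ hz, ?_, ?_⟩
  · rw [show φ z = φ.toEmbedding z from rfl, ← map_erase]
    exact (isDissoc_map φ _).2 hd
  · rwa [nbrsIn_map, card_map, card_map]

end map

lemma numDissoc_pathGraph_six [DecidableRel (SimpleGraph.pathGraph 6).Adj] :
    numDissoc (SimpleGraph.pathGraph 6) univ = 44 := by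
  have h : ∀ i j, (SimpleGraph.pathGraph 6).Adj i j ↔ (i.val + 1 = j.val ∨ j.val + 1 = i.val) :=
    fun i j => SimpleGraph.pathGraph_adj
  unfold numDissoc IsDissoc nbrsIn
  simp only [h]
  decide +kernel

lemma IsPathSixOn.nonempty_iso {V : Type*} [Fintype V] {T : SimpleGraph V} (h : IsPathSixOn T univ) :
    Nonempty (T ≃g SimpleGraph.pathGraph 6) := by
  obtain ⟨φ, hφ⟩ := h
  refine ⟨(RelIso.ofSurjective φ fun v => ?_).symm⟩
  obtain ⟨i, -, hi⟩ := mem_map.1 (hφ ▸ mem_univ v)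
  exact ⟨i, hi⟩

lemma IsPathSixOn.numDissoc_eq {V : Type*} {T : SimpleGraph V} [DecidableRel T.Adj] {A : Finset V} (h : IsPathSixOn T A) :
    numDissoc T A = 2 ^ (#A - 1) + excess #A := by
  classical
  obtain ⟨φ, rfl⟩ := h
  rw [numDissoc_map, numDissoc_pathGraph_six, card_map]
  rfl

lemma isSpiderOn_completeStar {r t : ℕ} [DecidableRel (completeStar r t 2).Adj] (hr : 0 < r)
    (hr2 : r ≤ 2) : IsSpiderOn (completeStar r t 2) univ := by
  refine ⟨Sum.inl ⟨0, hr⟩, mem_univ _, ?_, ?_⟩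
  · by_contra hn
    obtain ⟨w, hw, x, hx, y, hy, hwx, hwy, hxy⟩ := exists_two_of_not_isDissoc hn
    simp only [mem_erase, mem_univ, and_true] at hw hx hy
    -- a vertex other than the centre has at most one neighbour other than the centre
    have haux : ∀ s s' : Fin 2, s ≠ s' → s' = 1 - s := by decide
    have hinl : ∀ {a : Fin r}, (Sum.inl a : Fin r ⊕ Fin t × Fin 2) ≠ Sum.inl ⟨0, hr⟩ →
        a.val = 1 := by
      intro a ha
      have : a.val ≠ 0 := fun h => ha (congrArg Sum.inl (Fin.ext h))
      omega
    rcases w with w | ⟨i, s⟩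
    · have hcontra : ∀ {x}, x ≠ Sum.inl ⟨0, hr⟩ → ¬ (completeStar r t 2).Adj (Sum.inl w) x := by
        rintro (x | x) hx h
        · exact h (Fin.ext ((hinl hw).trans (hinl hx).symm))
        · exact absurd h.1 (by rw [hinl hw]; exact one_ne_zero)
      exact hcontra hx hwx
    · have hform : ∀ {x}, x ≠ Sum.inl ⟨0, hr⟩ → (completeStar r t 2).Adj (Sum.inr (i, s)) x →
          x = Sum.inr (i, 1 - s) := by
        rintro (x | ⟨j, s'⟩) hx h
        · exact absurd h.1 (by rw [hinl hx]; exact one_ne_zero)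
        · obtain ⟨h1, h2⟩ : i = j ∧ s ≠ s' := h
          rw [h1, show s' = 1 - s from haux s s' h2]
      exact hxy ((hform hx hwx).trans (hform hy hwy).symm)
  · have hsub : nbrsIn (completeStar r t 2) univ (Sum.inl ⟨0, hr⟩) ⊆
        (univ.erase ⟨0, hr⟩).image Sum.inl ∪ univ.image fun i => Sum.inr (i, 0) := by
      intro w hw
      have hadj := (mem_nbrsIn.1 hw).2
      rcases w with w | ⟨i, s⟩
      · refine mem_union_left _ (mem_image_of_mem _ (mem_erase.2 ⟨?_, mem_univ _⟩))
        exact Ne.symm hadj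
      · refine mem_union_right _ (mem_image.2 ⟨i, mem_univ _, ?_⟩)
        have : s = 0 := Fin.ext hadj.2
        rw [this]
    have h1 := (card_le_card hsub).trans (card_union_le _ _)
    have h2 := card_image_le (s := univ.erase (⟨0, hr⟩ : Fin r))
      (f := (Sum.inl : Fin r → Fin r ⊕ Fin t × Fin 2))
    have h3 := card_image_le (s := (univ : Finset (Fin t)))
      (f := fun i => (Sum.inr (i, 0) : Fin r ⊕ Fin t × Fin 2))
    rw [card_erase_of_mem (mem_univ _), card_univ, Fintype.card_fin] at h2
    rw [card_univ, Fintype.card_fin] at h3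
    rw [card_univ, Fintype.card_sum, Fintype.card_prod, Fintype.card_fin, Fintype.card_fin,
      Fintype.card_fin]
    omega

section iso

variable {V : Type*} [Fintype V] [DecidableEq V] {T : SimpleGraph V} [DecidableRel T.Adj]

/-- A tree in which `z` leaves only components with at most two vertices is `K_r ∗ t K_2`, provided
that `z` and the leaves adjacent to it form a complete graph, enumerated by `f`. -/
lemma IsTreeOn.exists_iso_completeStar (hT : IsTreeOn T univ) {z : V}
    (hd : IsDissoc T (univ.erase z)) {r : ℕ} (f : Fin r → V) (hfz : ∀ a, f a = z ↔ a.val = 0)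
    (hfadj : ∀ a b, T.Adj (f a) (f b) ↔ a ≠ b)
    (hf : ∀ v, (∃ a, f a = v) ↔ v = z ∨ (T.Adj z v ∧ ∀ p, T.Adj v p → p = z)) :
    ∃ t, Nonempty (T ≃g completeStar r t 2) := by
  obtain ⟨t, ⟨e⟩⟩ := Finite.exists_equiv_fin {c : V // T.Adj z c ∧ ∃ p, p ≠ z ∧ T.Adj c p}
  obtain ⟨c, hc⟩ : ∃ c : Fin t → V, c = fun i => (e.symm i : V) := ⟨_, rfl⟩
  have hzc : ∀ i, T.Adj z (c i) := fun i => by rw [hc]; exact (e.symm i).2.1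
  have hg : ∀ i, ∃ p, p ≠ z ∧ T.Adj (c i) p := fun i => by rw [hc]; exact (e.symm i).2.2
  have hcinj : Function.Injective c := by
    rw [hc]; exact Subtype.val_injective.comp e.symm.injective
  have hcsurj : ∀ v, T.Adj z v → (∃ p, p ≠ z ∧ T.Adj v p) → ∃ i, c i = v := fun v h1 h2 =>
    ⟨e ⟨v, h1, h2⟩, by rw [hc]; simp⟩
  -- `c` enumerates the neighbours of `z` of degree two, and `g` their second neighbours
  choose g hgz hcg using hg
  have huniq : ∀ {w x y : V}, w ≠ z → x ≠ z → y ≠ z → T.Adj w x → T.Adj w y → x = y := by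
    intro w x y hw hx hy h1 h2
    by_contra hxy
    exact not_isDissoc_of_two (mem_erase.2 ⟨hw, mem_univ w⟩) (mem_erase.2 ⟨hx, mem_univ x⟩)
      (mem_erase.2 ⟨hy, mem_univ y⟩) h1 h2 hxy hd
  have hzg : ∀ i, ¬ T.Adj z (g i) := fun i h =>
    hT.no_triangle (mem_univ _) (mem_univ _) (mem_univ _) (hzc i) (hcg i) h
  have hcz : ∀ i, c i ≠ z := fun i => (hzc i).ne'
  have hfc : ∀ a i, T.Adj (f a) (c i) ↔ a.val = 0 := by
    intro a i
    rw [← hfz]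
    refine ⟨fun h => ?_, fun h => by rw [h]; exact hzc i⟩
    rcases (hf (f a)).1 ⟨a, rfl⟩ with h' | ⟨-, h'⟩
    · exact h'
    · exact absurd (h' _ h) (hcz i)
  have hfg : ∀ a i, ¬ T.Adj (f a) (g i) := by
    intro a i h
    rcases (hf (f a)).1 ⟨a, rfl⟩ with h' | ⟨-, h'⟩
    · exact hzg i (h' ▸ h)
    · exact hgz i (h' _ h)
  have hcc : ∀ i j, ¬ T.Adj (c i) (c j) := fun i j h =>
    hT.no_triangle (mem_univ _) (mem_univ _) (mem_univ _) (hzc i) h (hzc j)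
  have hcg' : ∀ i j, T.Adj (c i) (g j) ↔ i = j := by
    refine fun i j => ⟨fun h => hcinj ?_, fun h => h ▸ hcg i⟩
    exact huniq (hgz j) (hcz i) (hcz j) h.symm (hcg j).symm
  have hgg : ∀ i j, ¬ T.Adj (g i) (g j) := by
    intro i j h
    have := huniq (hgz i) (hcz i) (hgz j) (hcg i).symm h
    exact hzg j (this ▸ hzc i)
  obtain ⟨F, hF⟩ : ∃ F : Fin r ⊕ Fin t × Fin 2 → V,
      F = Sum.elim f fun x => if x.2 = 0 then c x.1 else g x.1 := ⟨_, rfl⟩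
  have hF1 : ∀ a, F (Sum.inl a) = f a := fun a => by rw [hF]; rfl
  have hF2 : ∀ i, F (Sum.inr (i, 0)) = c i := fun i => by rw [hF]; simp
  have hF3 : ∀ i, F (Sum.inr (i, 1)) = g i := fun i => by rw [hF]; simp
  have hadj : ∀ x y, T.Adj (F x) (F y) ↔ (completeStar r t 2).Adj x y := by
    have hfc' := fun i a => (T.adj_comm (c i) (f a)).trans (hfc a i)
    have hfg' := fun i a => (not_congr (T.adj_comm (g i) (f a))).2 (hfg a i)
    have hgc' := fun j i => (T.adj_comm (g j) (c i)).trans (hcg' i j)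
    rintro (a | ⟨i, s⟩) (b | ⟨j, s'⟩)
    · rw [hF1, hF1, hfadj]; rfl
    · fin_cases s'
      · simp [hF1, hF2, hfc, completeStar]
      · simp [hF1, hF3, hfg, completeStar]
    · fin_cases s
      · simp [hF1, hF2, hfc', completeStar]
      · simp [hF1, hF3, hfg', completeStar]
    · fin_cases s <;> fin_cases s'
      · simp [hF2, hcc, completeStar]
      · simp [hF2, hF3, hcg', completeStar]
      · simp [hF2, hF3, hgc', completeStar, eq_comm]
      · simp [hF3, hgg, completeStar]
  have hfc_ne : ∀ a i, f a ≠ c i := by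
    intro a i h
    rcases (hf (f a)).1 ⟨a, rfl⟩ with h' | ⟨-, h'⟩
    · exact hcz i (h ▸ h')
    · exact hgz i (h' _ (h ▸ hcg i))
  have hfg_ne : ∀ a i, f a ≠ g i := by
    intro a i h
    rcases (hf (f a)).1 ⟨a, rfl⟩ with h' | ⟨h', -⟩
    · exact hgz i (h ▸ h')
    · exact hzg i (h ▸ h')
  have hcg_ne : ∀ i j, c i ≠ g j := fun i j h => hzg j (h ▸ hzc i)
  have hfinj : ∀ a b, f a = f b → a = b := by
    intro a b h
    by_contra hab
    exact ((hfadj a b).2 hab).ne h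
  have hginj : ∀ i j, g i = g j → i = j := fun i j h => (hcg' i j).1 (h ▸ hcg i)
  have hFinj : Function.Injective F := by
    rintro (a | ⟨i, s⟩) (b | ⟨j, s'⟩) h
    · rw [hF1, hF1] at h
      rw [hfinj a b h]
    · fin_cases s'
      · exact absurd (((hF1 a).symm.trans h).trans (hF2 j)) (hfc_ne a j)
      · exact absurd (((hF1 a).symm.trans h).trans (hF3 j)) (hfg_ne a j)
    · fin_cases s
      · exact absurd (((hF1 b).symm.trans h.symm).trans (hF2 i)) (hfc_ne b i)
      · exact absurd (((hF1 b).symm.trans h.symm).trans (hF3 i)) (hfg_ne b i)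
    · fin_cases s <;> fin_cases s'
      · rw [hcinj (((hF2 i).symm.trans h).trans (hF2 j))]
      · exact absurd (((hF2 i).symm.trans h).trans (hF3 j)) (hcg_ne i j)
      · exact absurd (((hF2 j).symm.trans h.symm).trans (hF3 i)) (hcg_ne j i)
      · rw [hginj _ _ (((hF3 i).symm.trans h).trans (hF3 j))]
  have hFsurj : Function.Surjective F := by
    intro v
    by_cases hv : ∃ a, f a = v
    · obtain ⟨a, rfl⟩ := hv
      exact ⟨_, hF1 a⟩
    · have hv' := mt (hf v).2 hv
      push Not at hv'
      by_cases hzv : T.Adj z v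
      · obtain ⟨p, hvp, hpz⟩ := hv'.2 hzv
        obtain ⟨i, rfl⟩ := hcsurj v hzv ⟨p, hpz, hvp⟩
        exact ⟨_, hF2 i⟩
      · obtain ⟨w, hw, hwv⟩ := hT.exists_common_nbr (mem_univ z) hd (mem_univ v) hv'.1 hzv
        obtain ⟨i, rfl⟩ := hcsurj w (mem_nbrsIn.1 hw).2 ⟨v, hv'.1, hwv⟩
        exact ⟨_, (hF3 i).trans (huniq (hcz i) (hgz i) hv'.1 (hcg i) hwv)⟩
  exact ⟨t, ⟨(RelIso.mk (Equiv.ofBijective F ⟨hFinj, hFsurj⟩) (hadj _ _)).symm⟩⟩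

/-- A spider that induces a tree on all vertices is `K_1 ∗ t K_2` or `K_2 ∗ t K_2`. -/
lemma IsSpiderOn.exists_iso (h : IsSpiderOn T univ) (hT : IsTreeOn T univ) :
    ∃ r t, (r = 1 ∨ r = 2) ∧ Nonempty (T ≃g completeStar r t 2) := by
  obtain ⟨z, -, hd, hk⟩ := h
  obtain ⟨L, hL⟩ : ∃ L : Finset V, L = {v ∈ nbrsIn T univ z | ∀ p, T.Adj v p → p = z} := ⟨_, rfl⟩
  have hLmem : ∀ v, v ∈ L ↔ T.Adj z v ∧ ∀ p, T.Adj v p → p = z := by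
    intro v; rw [hL, mem_filter, mem_nbrsIn]; simp
  -- the components of `T - z` are counted by the neighbours of `z`, those in `L` being singletons
  have hLsub : L ⊆ nbrsIn T univ z := hL ▸ filter_subset _ _
  have hcount : #(univ : Finset V) ≤ 1 + #(nbrsIn T univ z) + #(nbrsIn T univ z \ L) := by
    have hsub : (univ : Finset V) ⊆ insert z (nbrsIn T univ z) ∪
        (nbrsIn T univ z \ L).biUnion fun w => nbrsIn T (univ.erase z) w := by
      intro v _
      by_cases hvz : v = z
      · simp [hvz]
      by_cases hzv : T.Adj z v
      · simp [hzv]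
      obtain ⟨w, hw, hwv⟩ := hT.exists_common_nbr (mem_univ z) hd (mem_univ v) hvz hzv
      refine mem_union_right _ (mem_biUnion.2 ⟨w, mem_sdiff.2 ⟨hw, fun h => ?_⟩, ?_⟩)
      · exact hvz (((hLmem w).1 h).2 v hwv)
      · simp [hvz, hwv]
    have h1 := (card_le_card hsub).trans (card_union_le _ _)
    have h2 : #((nbrsIn T univ z \ L).biUnion fun w => nbrsIn T (univ.erase z) w) ≤
        #(nbrsIn T univ z \ L) * 1 := by
      refine card_biUnion_le_card_mul _ _ _ fun w hw => hd w ?_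
      have := mem_nbrsIn.1 (mem_sdiff.1 hw).1
      exact mem_erase.2 ⟨this.2.ne', this.1⟩
    have h3 := card_insert_le z (nbrsIn T univ z)
    omega
  rw [card_sdiff_of_subset hLsub] at hcount
  have hle := card_le_card hLsub
  obtain h0 | h1 : #L = 0 ∨ #L = 1 := by omega
  · rw [card_eq_zero] at h0
    obtain ⟨t, ht⟩ := hT.exists_iso_completeStar hd ![z] (by simp)
      (by intro a b; simp [Subsingleton.elim a b]) (by
        intro v
        have := hLmem v
        rw [h0] at this
        rw [← this]
        simp [eq_comm])
    exact ⟨1, t, Or.inl rfl, ht⟩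
  · obtain ⟨l, hl⟩ := card_eq_one.1 h1
    have hzl : T.Adj z l := ((hLmem l).1 (by simp [hl])).1
    obtain ⟨t, ht⟩ := hT.exists_iso_completeStar hd ![z, l]
      (by intro a; fin_cases a <;> simp [hzl.ne'])
      (by intro a b; fin_cases a <;> fin_cases b <;> simp [hzl, hzl.symm]) (by
        intro v
        rw [← hLmem, hl]
        simp [Fin.exists_fin_succ, eq_comm])
    exact ⟨2, t, Or.inr rfl, ht⟩

lemma isoExtremalTree_iff {n : ℕ} (hn : Fintype.card V = n) (hT : IsTreeOn T univ) :
    IsoExtremalTree n T ↔ IsSpiderOn T univ ∨ IsPathSixOn T univ := by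
  classical
  have hmap : ∀ {W : Type} [Fintype W] {H : SimpleGraph W} (φ : T ≃g H),
      univ.map φ.symm.toEmbedding.toEmbedding = (univ : Finset V) := by
    intro W _ H φ
    exact map_univ_equiv φ.symm.toEquiv
  have hspider : ∀ {r t : ℕ}, 0 < r → r ≤ 2 → Nonempty (T ≃g completeStar r t 2) →
      IsSpiderOn T univ := by
    rintro r t hr hr2 ⟨φ⟩
    have := (isSpiderOn_completeStar (t := t) hr hr2).map φ.symm.toEmbedding
    rwa [hmap φ] at this
  constructor
  · intro h
    unfold IsoExtremalTree at h
    split_ifs at h with h1 h2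
    · exact Or.inl (hspider one_pos one_le_two h)
    · rcases h with ⟨⟨φ⟩⟩ | h
      · exact Or.inr ⟨φ.symm.toEmbedding, (hmap φ).symm⟩
      · exact Or.inl (hspider two_pos le_rfl h)
    · exact Or.inl (hspider two_pos le_rfl h)
  · rintro (h | h)
    · obtain ⟨r, t, hr, ⟨φ⟩⟩ := h.exists_iso hT
      have hcard : n = r + t * 2 := by
        rw [← hn, Fintype.card_congr φ.toEquiv, Fintype.card_sum, Fintype.card_prod,
          Fintype.card_fin, Fintype.card_fin, Fintype.card_fin]
      unfold IsoExtremalTree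
      rcases hr with rfl | rfl
      · rw [if_pos (by rw [hcard, Nat.odd_iff]; omega), show (n - 1) / 2 = t by omega]
        exact ⟨φ⟩
      · rw [if_neg (by rw [hcard, Nat.odd_iff]; omega)]
        split_ifs with h6
        · obtain rfl : t = 2 := by omega
          exact Or.inr ⟨φ⟩
        · rw [show (n - 2) / 2 = t by omega]
          exact ⟨φ⟩
    · obtain ⟨φ⟩ := h.nonempty_iso
      have hcard : n = 6 := by rw [← hn, Fintype.card_congr φ.toEquiv, Fintype.card_fin]
      subst hcard
      unfold IsoExtremalTree
      rw [if_neg (by decide), if_pos rfl]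
      exact Or.inl ⟨φ⟩

end iso

/-! ### The extremal value in closed form -/

lemma extremalValue_eq {n : ℕ} (hn : 0 < n) :
    extremalValue n = ((2 ^ (n - 1) + excess n : ℕ) : ℚ) := by
  have hpow : (2 : ℚ) ^ ((n : ℤ) - 1) = 2 ^ (n - 1) := by
    rw [← zpow_natCast, Nat.cast_sub hn, Nat.cast_one]
  unfold extremalValue
  rw [hpow]
  push_cast
  obtain ⟨m, rfl | rfl⟩ := Nat.even_or_odd' n
  · obtain ⟨j, rfl⟩ : ∃ j, m = j + 1 := ⟨m - 1, by omega⟩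
    rw [if_neg (by simp)]
    have h := two_mul_excess_even j
    have h' : (2 : ℚ) * excess (2 * j + 2) = (j + 4) * 2 ^ j := by exact_mod_cast h
    rw [show (((2 * (j + 1) : ℕ) : ℤ) - 6) / 2 = (j : ℤ) - 2 by push_cast; omega,
      zpow_sub₀ two_ne_zero, zpow_natCast, show 2 * (j + 1) = 2 * j + 2 by ring]
    push_cast
    norm_num
    linear_combination (-1 / 2 : ℚ) * h'
  · rw [if_pos (by simp)]
    have h := two_mul_excess_odd m
    have h' : (2 : ℚ) * excess (2 * m + 1) = (m + 2) * 2 ^ m := by exact_mod_cast h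
    rw [show (((2 * m + 1 : ℕ) : ℤ) - 5) / 2 = (m : ℤ) - 2 by push_cast; omega,
      zpow_sub₀ two_ne_zero, zpow_natCast]
    push_cast
    norm_num
    linear_combination (-1 / 2 : ℚ) * h'

end

theorem theorem3p1 {V : Type*} [Fintype V] (n : ℕ) (hn : Fintype.card V = n)
    (T : SimpleGraph V) (hT : T.IsTree) :
    (numDissociationSets T : ℚ) ≤ extremalValue n ∧
      ((numDissociationSets T : ℚ) = extremalValue n ↔ IsoExtremalTree n T) := by
  classical
  have hT' := hT.isTreeOn_univ
  have := hT.connected.nonempty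
  have hpos : 0 < n := hn ▸ Fintype.card_pos
  obtain ⟨hle, heq⟩ := hT'.satisfiesBound
  rw [Finset.card_univ, hn] at hle heq
  rw [numDissociationSets_eq, extremalValue_eq hpos, isoExtremalTree_iff hn hT', Nat.cast_le,
    Nat.cast_inj]
  refine ⟨hle, heq, ?_⟩
  rintro (h | h)
  · have := h.numDissoc_eq hT'
    rwa [Finset.card_univ, hn] at this
  · have := h.numDissoc_eq
    rwa [Finset.card_univ, hn] at this
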